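/- Let $N\ge 1$, $m,n_i,k_i\ge 0$, $t_0\in\mathbb R$, $\mathcal N=\{1,\dots,N\}$, and let $\|\cdot\|_\infty$ denote the maximum norm and the induced matrix norm. Consider agents $$\dot y_i=F_i(t,y_i,z_i)+\Gamma_i(t,w_i)u_i,\qquad \dot z_i=Z_i(t,z_i,y_i),\qquad w_i=W_i(y_i,z_i),\qquad i\in\mathcal N,$$ with $y_i(t)\in\mathbb R^m$, $z_i(t)\in\mathbb R^{n_i}$, $w_i(t)\in\mathbb R^{k_i}$, coupled over a graph $(\mathcal N,\mathcal E)$ with neighborhoods $\mathcal N_i$ by the edge-wise funnel law $$u_i=\Gamma_i(t,w_i)^{-1}\sum_{j\in\mathcal N_i}u_{ij},\qquad u_{ij}^p=\mu_{ij}^p\!\left(\frac{y_j^p-y_i^p}{\psi_{ij}^p(t)}\right),\quad p=1,\dots,m .$$ Assume: 1. For $t\ge t_0$, $F_i,Z_i,\Gamma_i$ are measurable in $t$, locally Lipschitz in the remaining variables (with a Lipschitz constant that is locally integrable in $t$), and bounded on compact sets of the remaining variables uniformly in $t$; $W_i$ is locally Lipschitz. 2. $\Gamma_i(t,w)$ is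 invertible for all $i$, $t\ge t_0$, $w$, and $\|\Gamma_i(t,w)^{-1}\|_\infty\le M_\Gamma$ for some constant $M_\Gamma$. 3. The graph is undirected and connected. 4. For every edge and every $p$: $\psi_{ij}^p=\psi_{ji}^p:[t_0,\infty)\to(0,\infty)$ is bounded and $C^1$ with bounded derivative; $\mu_{ij}^p:(-1,1)\to\mathbb R$ is continuous, $\mu_{ij}^p(s)\to\pm\infty$ as $s\to\pm1$, and $\mu_{ij}^p(-s)=-\mu_{ji}^p(s)$. 5. Let $d$ be the diameter of the graph and $\Psi(t)=\max_{p,(i,j)\in\mathcal E}\psi_{ij}^p(t)$. For all locally absolutely continuous $e_i:[t_0,\infty)\to\mathbb R^m$ with $\|e_i(t)\|_\infty\le d\,\Psi(t)$ and all initial values at $t_0$, the system $\dot s=\frac1N\sum_{i}F_i(t,s+e_i,z_i)$, $\dot z_i=Z_i(t,z_i,s+e_i)$, $i\in\mathcal N$, has a Carathéodory solution on $[t_0,\infty)$. Let initial values at $t_0$ be given with $|y_j^p(t_0)-y_i^p(t_0)|<\psi_{ij}^p(t_0)$ for every edge and every $p$. Then the closed loop has a maximal Carathéodory solution with these initial values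 (a solution satisfies $|y_j^p-y_i^p|<\psi_{ij}^p$ for every edge and every $p$ throughout its interval of existence, since $\mu_{ij}^p$ is defined on $(-1,1)$). Let $(y_i,z_i)_{i\in\mathcal N}$ be any such maximal solution, on $[t_0,\omega)$ with $\omega\le\infty$, and suppose that at least one of the following holds. (a) $F_i(t,y,z)=\widehat F(t,y)+\widetilde F_i(t,y,z)$ for all $i$ and $t\ge t_0$, where $\widehat F$ is globally Lipschitz in $y$ uniformly in $t$, and $\|\widetilde F_i(t,y,z)\|_\infty\le M_F$ for all $i$, $t\ge t_0$, $y$, $z$, with some constant $M_F$. (b) There is a constant $M$ with $\|(y_i(t),z_i(t))\|_\infty\le M$ for all $i$ and all $t\in[t_0,\omega)$. Then $\omega=\infty$, and the inputs are bounded on $[t_0,\infty)$: there is $M_u>0$ with $\|u_i(t)\|_\infty\le M_u$ for all $t\ge t_0$ and all $i\in\mathcal N$. (The functions $\psi_{ij}^p$ may tend to zero as $t\to\infty$.) -/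

import Mathlib

open Set Filter Topology MeasureTheory

/-! Vectors `Fin d → ℝ` (and pairs of such) carry the maximum norm. Matrices carry the induced
maximum norm (the maximal absolute row sum). -/
attribute [local instance] Matrix.linftyOpNormedAddCommGroup

/-- `f : [t₀, ∞) × X → E` is (Lebesgue) measurable in `t`, locally Lipschitz in `x` (with a
Lipschitz constant that is locally integrable in `t`), and bounded on each compact subset of `X`
uniformly in `t`. Only the values at `t ≥ t₀` matter. -/
structure IsCaratheodoryField {X E : Type*} [NormedAddCommGroup X] [NormedAddCommGroup E]
    (t₀ : ℝ) (f : ℝ → X → E) : Prop where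
  measurable : ∀ x, AEStronglyMeasurable (fun t => f t x) (volume.restrict (Ici t₀))
  locallyLipschitz : ∀ x₀, ∃ U ∈ 𝓝 x₀, ∃ L : ℝ → ℝ, LocallyIntegrableOn L (Ici t₀) ∧
    ∀ t, t₀ ≤ t → ∀ x ∈ U, ∀ x' ∈ U, ‖f t x - f t x'‖ ≤ L t * ‖x - x'‖
  bounded : ∀ K : Set X, IsCompact K → ∃ M : ℝ, ∀ t, t₀ ≤ t → ∀ x ∈ K, ‖f t x‖ ≤ M

/-- `x` is (locally) absolutely continuous on `[t₀, ω)` and `x' = v` almost everywhere there: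
the Carathéodory meaning of the differential equation `x'(t) = v(t)` on `[t₀, ω)`. -/
def HasCaratheodoryDeriv {E : Type*} [NormedAddCommGroup E] [NormedSpace ℝ E]
    (t₀ : ℝ) (ω : EReal) (x v : ℝ → E) : Prop :=
  (∀ T : ℝ, t₀ ≤ T → (T : EReal) < ω → AbsolutelyContinuousOnInterval x t₀ T) ∧
  ∀ᵐ t : ℝ, t₀ < t → (t : EReal) < ω → HasDerivAt x (v t) t

/-- The data of `N` heterogeneous agents on `[t₀, ∞)`
`y_i' = F_i(t, y_i, z_i) + Γ_i(t, w_i) u_i`, `z_i' = Z_i(t, z_i, y_i)`, `w_i = W_i(y_i, z_i)`,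
with outputs `y_i ∈ ℝ^m`, internal states `z_i ∈ ℝ^(n i)` and introspective outputs
`w_i ∈ ℝ^(k i)`. -/
structure AgentNetwork (N m : ℕ) (n k : Fin N → ℕ) where
  t₀ : ℝ
  F : (i : Fin N) → ℝ → (Fin m → ℝ) → (Fin (n i) → ℝ) → (Fin m → ℝ)
  Z : (i : Fin N) → ℝ → (Fin (n i) → ℝ) → (Fin m → ℝ) → (Fin (n i) → ℝ)
  Γ : (i : Fin N) → ℝ → (Fin (k i) → ℝ) → Matrix (Fin m) (Fin m) ℝ
  W : (i : Fin N) → (Fin m → ℝ) → (Fin (n i) → ℝ) → (Fin (k i) → ℝ)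

/-- The data of an edge-wise funnel coupling: an undirected communication graph, performance
functions `ψ i j p` and coupling functions `μ i j p`; the values `ψ i j p`, `μ i j p` matter only
when `i` and `j` are adjacent, those of `ψ i j p` only on `[t₀, ∞)`, those of `μ i j p` only on
`(-1, 1)`. -/
structure FunnelCoupling (N m : ℕ) where
  graph : SimpleGraph (Fin N)
  ψ : Fin N → Fin N → Fin m → ℝ → ℝ
  μ : Fin N → Fin N → Fin m → ℝ → ℝ

namespace FunnelCoupling

variable {N m : ℕ}

/-- Symmetric performance and coupling functions on a connected graph. -/
structure IsAdmissible (c : FunnelCoupling N m) (t₀ : ℝ) : Prop where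
  connected : c.graph.Connected
  ψ_pos : ∀ i j, c.graph.Adj i j → ∀ p t, t₀ ≤ t → 0 < c.ψ i j p t
  ψ_bounded : ∀ i j, c.graph.Adj i j → ∀ p, ∃ B : ℝ, ∀ t, t₀ ≤ t → c.ψ i j p t ≤ B
  ψ_contDiff : ∀ i j, c.graph.Adj i j → ∀ p, ContDiffOn ℝ 1 (c.ψ i j p) (Ici t₀)
  ψ_deriv_bounded : ∀ i j, c.graph.Adj i j → ∀ p, ∃ B : ℝ, ∀ t, t₀ ≤ t →
    |derivWithin (c.ψ i j p) (Ici t₀) t| ≤ B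
  ψ_symm : ∀ i j, c.graph.Adj i j → ∀ p t, t₀ ≤ t → c.ψ i j p t = c.ψ j i p t
  μ_cont : ∀ i j, c.graph.Adj i j → ∀ p, ContinuousOn (c.μ i j p) (Ioo (-1) 1)
  μ_right : ∀ i j, c.graph.Adj i j → ∀ p, Tendsto (c.μ i j p) (𝓝[<] 1) atTop
  μ_left : ∀ i j, c.graph.Adj i j → ∀ p, Tendsto (c.μ i j p) (𝓝[>] (-1)) atBot
  μ_symm : ∀ i j, c.graph.Adj i j → ∀ p, ∀ s ∈ Ioo (-1 : ℝ) 1, c.μ i j p (-s) = -c.μ j i p s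

/-- The outputs `y` lie inside the funnel at time `t`: `|y_j^p - y_i^p| < ψ_ij^p(t)` for every
edge and every component. -/
def InFunnel (c : FunnelCoupling N m) (t : ℝ) (y : Fin N → Fin m → ℝ) : Prop :=
  ∀ i j, c.graph.Adj i j → ∀ p, |y j p - y i p| < c.ψ i j p t

/-- `Ψ(t)`, the largest performance function over all edges and components at time `t`
(and `0` if there are none). -/
noncomputable def Psi (c : FunnelCoupling N m) (t : ℝ) : ℝ :=
  ⨆ q : {q : Fin N × Fin N × Fin m // c.graph.Adj q.1 q.2.1}, c.ψ q.1.1 q.1.2.1 q.1.2.2 t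

open Classical in
/-- `∑_{j ∈ 𝒩_i} u_ij(t, y_j - y_i)` where `u_ij^p(t, ν) = μ_ij^p(ν^p / ψ_ij^p(t))`. -/
noncomputable def edgeSum (c : FunnelCoupling N m) (i : Fin N) (t : ℝ) (y : Fin N → Fin m → ℝ) :
    Fin m → ℝ :=
  ∑ j with c.graph.Adj i j, fun p => c.μ i j p ((y j p - y i p) / c.ψ i j p t)

end FunnelCoupling

namespace AgentNetwork

variable {N m : ℕ} {n k : Fin N → ℕ}

/-- Regularity of the open loop dynamics. -/
structure IsRegular (S : AgentNetwork N m n k) : Prop where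
  F_field : ∀ i, IsCaratheodoryField S.t₀
    (fun t (x : (Fin m → ℝ) × (Fin (n i) → ℝ)) => S.F i t x.1 x.2)
  Z_field : ∀ i, IsCaratheodoryField S.t₀
    (fun t (x : (Fin m → ℝ) × (Fin (n i) → ℝ)) => S.Z i t x.2 x.1)
  Γ_field : ∀ i, IsCaratheodoryField S.t₀ (S.Γ i)
  W_lipschitz : ∀ i, LocallyLipschitz
    (fun x : (Fin m → ℝ) × (Fin (n i) → ℝ) => S.W i x.1 x.2)

/-- The gain matrices are invertible, with uniformly bounded inverses. -/
def HasBoundedInverseGain (S : AgentNetwork N m n k) : Prop :=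
  (∀ i t w, S.t₀ ≤ t → IsUnit (S.Γ i t w)) ∧
  ∃ M : ℝ, 0 < M ∧ ∀ i t w, S.t₀ ≤ t → ‖(S.Γ i t w)⁻¹‖ ≤ M

/-- The edge-wise funnel coupling law
`u_i = Γ_i(t, w_i)⁻¹ ∑_{j ∈ 𝒩_i} u_ij(t, y_j - y_i)` with `w_i = W_i(y_i, z_i)`. -/
noncomputable def input (S : AgentNetwork N m n k) (c : FunnelCoupling N m) (i : Fin N) (t : ℝ)
    (y : Fin N → Fin m → ℝ) (z : (i : Fin N) → Fin (n i) → ℝ) : Fin m → ℝ :=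
  (S.Γ i t (S.W i (y i) (z i)))⁻¹.mulVec (c.edgeSum i t y)

/-- `(y, z)` is a Carathéodory solution of the closed loop on `[t₀, ω)`, `t₀ < ω ≤ ∞`.
The coupling functions live on `(-1, 1)`, so a solution stays inside the funnel by definition. -/
structure IsSolution (S : AgentNetwork N m n k) (c : FunnelCoupling N m) (ω : EReal)
    (y : ℝ → Fin N → Fin m → ℝ) (z : ℝ → (i : Fin N) → Fin (n i) → ℝ) : Prop where
  lt : (S.t₀ : EReal) < ω
  inFunnel : ∀ t, S.t₀ ≤ t → (t : EReal) < ω → c.InFunnel t (y t)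
  y_deriv : ∀ i, HasCaratheodoryDeriv S.t₀ ω (fun t => y t i)
    (fun t => S.F i t (y t i) (z t i)
      + (S.Γ i t (S.W i (y t i) (z t i))).mulVec (S.input c i t (y t) (z t)))
  z_deriv : ∀ i, HasCaratheodoryDeriv S.t₀ ω (fun t => z t i) (fun t => S.Z i t (z t i) (y t i))

/-- A solution on `[t₀, ω)` that has no proper extension. -/
def IsMaximalSolution (S : AgentNetwork N m n k) (c : FunnelCoupling N m) (ω : EReal)
    (y : ℝ → Fin N → Fin m → ℝ) (z : ℝ → (i : Fin N) → Fin (n i) → ℝ) : Prop :=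
  S.IsSolution c ω y z ∧
  ∀ ω' y' z', S.IsSolution c ω' y' z' → ω ≤ ω' →
    (∀ t, S.t₀ ≤ t → (t : EReal) < ω → y' t = y t ∧ z' t = z t) → ω' = ω

/-- The perturbed blended dynamics
`s' = (1/N) ∑ F_i(t, s + e_i, z_i)`, `z_i' = Z_i(t, z_i, s + e_i)`
has a global solution on `[t₀, ∞)` for all initial values and all absolutely continuous inputs
`e_i` with `‖e_i(t)‖ ≤ d Ψ(t)`, where `d` is the diameter of the graph. -/
def NoFiniteEscape (S : AgentNetwork N m n k) (c : FunnelCoupling N m) : Prop :=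
  ∀ e : ℝ → Fin N → Fin m → ℝ,
    (∀ i, ∀ T : ℝ, S.t₀ ≤ T → AbsolutelyContinuousOnInterval (fun t => e t i) S.t₀ T) →
    (∀ i t, S.t₀ ≤ t → ‖e t i‖ ≤ (c.graph.diam : ℝ) * c.Psi t) →
    ∀ (s₀ : Fin m → ℝ) (z₀ : (i : Fin N) → Fin (n i) → ℝ),
      ∃ (s : ℝ → Fin m → ℝ) (z : ℝ → (i : Fin N) → Fin (n i) → ℝ),
        s S.t₀ = s₀ ∧ z S.t₀ = z₀ ∧
        HasCaratheodoryDeriv S.t₀ ⊤ s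
          (fun t => (1 / (N : ℝ)) • ∑ i, S.F i t (s t + e t i) (z t i)) ∧
        ∀ i, HasCaratheodoryDeriv S.t₀ ⊤ (fun t => z t i)
          (fun t => S.Z i t (z t i) (s t + e t i))

/-- `F_i(t, y, z) = F̂(t, y) + F̃_i(t, y, z)` with `F̂` globally Lipschitz in `y` uniformly in `t`
and all `F̃_i` bounded by one constant. -/
def HasLipschitzPlusBoundedSplitting (S : AgentNetwork N m n k) : Prop :=
  ∃ (Fhat : ℝ → (Fin m → ℝ) → (Fin m → ℝ))
    (Ftilde : (i : Fin N) → ℝ → (Fin m → ℝ) → (Fin (n i) → ℝ) → (Fin m → ℝ)),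
    (∀ i t y z, S.t₀ ≤ t → S.F i t y z = Fhat t y + Ftilde i t y z) ∧
    (∃ L : ℝ, ∀ t y y', S.t₀ ≤ t → ‖Fhat t y - Fhat t y'‖ ≤ L * ‖y - y'‖) ∧
    ∃ M : ℝ, ∀ i t y z, S.t₀ ≤ t → ‖Ftilde i t y z‖ ≤ M

/-- The states `(y_i, z_i)` are uniformly bounded on the interval `[t₀, ω)` of existence. -/
def HasBoundedStates (S : AgentNetwork N m n k) (ω : EReal)
    (y : ℝ → Fin N → Fin m → ℝ) (z : ℝ → (i : Fin N) → Fin (n i) → ℝ) : Prop :=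
  ∃ M : ℝ, ∀ i t, S.t₀ ≤ t → (t : EReal) < ω → ‖(y t i, z t i)‖ ≤ M

end AgentNetwork

/-!
If the drifts `F_i` differ by a bounded amount along a solution, which holds under (a) as well as
under (b), then one component of the outputs cannot reach the funnel boundary: order the edges along
which a set `U` of agents is assembled into a tree, shrink the funnel of the `h`-th edge by the
factor `1 - ε_h`, and let `θ` be the sum of the shrunk funnels. When the spread of `U` first equals
`θ`, some edge at one of the two extremal agents is within the relative distance `ε_h` of its
boundary, for `h = |U|`, and pulls them together, while no edge that pulls them apart is closer than
`ε_{h+1}`. If `ε_h` is small enough compared with `ε_{h+1}`, the spread decreases faster than `θ`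
can. The trees with a single edge give a uniform margin, so that all couplings stay bounded.

The couplings cancel in the average `s` of the outputs, whence `s` and the `z_i` solve the blended
dynamics with the deviations `e_i = y_i - s`. These are bounded by `d Ψ` and Lipschitz, by the
margin, and therefore extend to admissible perturbations on `[t₀, ∞)`. Uniqueness for the blended
dynamics bounds the states on every finite interval of existence, and a maximal solution with
bounded states and a margin is global.
-/

/-! ### Carathéodory derivatives -/

theorem absolutelyContinuousOnInterval_of_eqOn {X : Type*} [PseudoMetricSpace X] {f g : ℝ → X}
    {a b : ℝ} (hf : AbsolutelyContinuousOnInterval f a b) (h : EqOn f g (uIcc a b)) :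
    AbsolutelyContinuousOnInterval g a b := by
  rw [absolutelyContinuousOnInterval_iff] at hf ⊢
  intro ε hε
  obtain ⟨δ, hδ, H⟩ := hf ε hε
  refine ⟨δ, hδ, fun E hE hlen => ?_⟩
  refine lt_of_eq_of_lt (Finset.sum_congr rfl fun i hi => ?_) (H E hE hlen)
  rw [h (hE.1 i hi).1, h (hE.1 i hi).2]

theorem absolutelyContinuousOnInterval_lipschitzWith_comp {X Y : Type*} [PseudoMetricSpace X]
    [PseudoMetricSpace Y] {K : NNReal} {g : X → Y} (hg : LipschitzWith K g) {f : ℝ → X} {a b : ℝ}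
    (hf : AbsolutelyContinuousOnInterval f a b) :
    AbsolutelyContinuousOnInterval (fun t => g (f t)) a b := by
  have hK := Tendsto.const_mul (K : ℝ) hf
  rw [mul_zero] at hK
  refine squeeze_zero (fun E => Finset.sum_nonneg fun i _ => dist_nonneg) (fun E => ?_) hK
  rw [Finset.mul_sum]
  exact Finset.sum_le_sum fun i _ => hg.dist_le_mul _ _

theorem absolutelyContinuousOnInterval_finset_sum {ι E : Type*} [NormedAddCommGroup E]
    (s : Finset ι) {f : ι → ℝ → E} {a b : ℝ}
    (hf : ∀ i ∈ s, AbsolutelyContinuousOnInterval (f i) a b) :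
    AbsolutelyContinuousOnInterval (fun t => ∑ i ∈ s, f i t) a b := by
  classical
  induction s using Finset.induction_on with
  | empty =>
    simp only [Finset.sum_empty]
    exact (LipschitzWith.const (0 : E)).lipschitzOnWith.absolutelyContinuousOnInterval
  | insert i s hi ih =>
    simp only [Finset.sum_insert hi]
    exact (hf i (Finset.mem_insert_self i s)).fun_add
      (ih fun j hj => hf j (Finset.mem_insert_of_mem hj))

theorem lipschitzOnWith_of_norm_sub_le {E : Type*} [SeminormedAddCommGroup E] {f : ℝ → E}
    {K : NNReal} {s : Set ℝ} (h : ∀ a ∈ s, ∀ b ∈ s, a ≤ b → ‖f b - f a‖ ≤ K * (b - a)) :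
    LipschitzOnWith K f s := by
  refine LipschitzOnWith.of_dist_le_mul fun a ha b hb => ?_
  rcases le_total a b with hab | hab
  · rw [dist_comm, dist_eq_norm, dist_comm, Real.dist_eq, abs_of_nonneg (sub_nonneg.2 hab)]
    exact h a ha b hb hab
  · rw [dist_eq_norm, Real.dist_eq, abs_of_nonneg (sub_nonneg.2 hab)]
    exact h b hb a ha hab

theorem lipschitzOnWith_ite_lt {E : Type*} [SeminormedAddCommGroup E] {f g : ℝ → E}
    {K : NNReal} {a b c : ℝ} (hf : LipschitzOnWith K f (Icc a b))
    (hg : LipschitzOnWith K g (Icc b c)) (hb : f b = g b) :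
    LipschitzOnWith K (fun t => if t < b then f t else g t) (Icc a c) := by
  have hf' : ∀ s ∈ Icc a b, ∀ t ∈ Icc a b, s ≤ t → ‖f t - f s‖ ≤ K * (t - s) :=
    fun s hs t ht hst => by
      simpa only [Real.norm_eq_abs, abs_of_nonneg (sub_nonneg.2 hst)] using hf.norm_sub_le ht hs
  have hg' : ∀ s ∈ Icc b c, ∀ t ∈ Icc b c, s ≤ t → ‖g t - g s‖ ≤ K * (t - s) :=
    fun s hs t ht hst => by
      simpa only [Real.norm_eq_abs, abs_of_nonneg (sub_nonneg.2 hst)] using hg.norm_sub_le ht hs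
  refine lipschitzOnWith_of_norm_sub_le fun s hs t ht hst => ?_
  rcases lt_or_ge t b with htb | htb
  · simp only [htb, hst.trans_lt htb, if_true]
    exact hf' s ⟨hs.1, (hst.trans_lt htb).le⟩ t ⟨ht.1, htb.le⟩ hst
  rcases lt_or_ge s b with hsb | hsb
  · simp only [hsb, not_lt.2 htb, if_true, if_false]
    calc ‖g t - f s‖ = ‖(g t - g b) + (f b - f s)‖ := by rw [hb, sub_add_sub_cancel]
      _ ≤ K * (t - b) + K * (b - s) := norm_add_le_of_le
          (hg' b ⟨le_rfl, htb.trans ht.2⟩ t ⟨htb, ht.2⟩ htb)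
          (hf' s ⟨hs.1, hsb.le⟩ b ⟨hs.1.trans hsb.le, le_rfl⟩ hsb.le)
      _ = K * (t - s) := by ring
  · simp only [not_lt.2 hsb, not_lt.2 htb, if_false]
    exact hg' s ⟨hsb, hs.2⟩ t ⟨htb, ht.2⟩ hst

theorem eventually_integral_le {Λ : ℝ → ℝ} {t T : ℝ} (htT : t < T)
    (hΛ : IntegrableOn Λ (Icc t T)) {η : ℝ} (hη : 0 < η) :
    ∀ᶠ τ in 𝓝[>] t, ∫ r in t..τ, Λ r ≤ η := by
  have hcont := intervalIntegral.continuousOn_primitive_interval (by rwa [uIcc_of_le htT.le])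
  rw [uIcc_of_le htT.le] at hcont
  have hlim := (hcont t (left_mem_Icc.2 htT.le)).tendsto
  rw [intervalIntegral.integral_same] at hlim
  exact (hlim.mono_left (nhdsWithin_le_of_mem (mem_of_superset (Ioo_mem_nhdsGT htT)
    Ioo_subset_Icc_self))).eventually_le_const hη

namespace HasCaratheodoryDeriv

variable {E G : Type*} [NormedAddCommGroup E] [NormedSpace ℝ E] [NormedAddCommGroup G]
  [NormedSpace ℝ G] {t₀ : ℝ} {ω : EReal} {x v : ℝ → E}

theorem clm_comp (h : HasCaratheodoryDeriv t₀ ω x v) (L : E →L[ℝ] G) :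
    HasCaratheodoryDeriv t₀ ω (fun t => L (x t)) (fun t => L (v t)) := by
  refine ⟨fun T hT hTω =>
    absolutelyContinuousOnInterval_lipschitzWith_comp L.lipschitz (h.1 T hT hTω), ?_⟩
  filter_upwards [h.2] with t ht ht₀ htω
  exact L.hasFDerivAt.comp_hasDerivAt t (ht ht₀ htω)

theorem apply {ι : Type*} [Fintype ι] {F : ι → Type*} [∀ i, NormedAddCommGroup (F i)]
    [∀ i, NormedSpace ℝ (F i)] {x v : ℝ → ∀ i, F i} (h : HasCaratheodoryDeriv t₀ ω x v) (i : ι) :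
    HasCaratheodoryDeriv t₀ ω (fun t => x t i) (fun t => v t i) :=
  h.clm_comp (ContinuousLinearMap.proj i)

theorem finset_sum {ι : Type*} (s : Finset ι) {x v : ι → ℝ → E}
    (h : ∀ i ∈ s, HasCaratheodoryDeriv t₀ ω (x i) (v i)) :
    HasCaratheodoryDeriv t₀ ω (fun t => ∑ i ∈ s, x i t) (fun t => ∑ i ∈ s, v i t) := by
  refine ⟨fun T hT hTω => absolutelyContinuousOnInterval_finset_sum s
    fun i hi => (h i hi).1 T hT hTω, ?_⟩
  filter_upwards [(Finset.eventually_all s).2 fun i hi => (h i hi).2] with t ht ht₀ htω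
  exact HasDerivAt.fun_sum fun i hi => ht i hi ht₀ htω

theorem sub {x' v' : ℝ → E} (h : HasCaratheodoryDeriv t₀ ω x v)
    (h' : HasCaratheodoryDeriv t₀ ω x' v') :
    HasCaratheodoryDeriv t₀ ω (fun t => x t - x' t) (fun t => v t - v' t) := by
  refine ⟨fun T hT hTω => (h.1 T hT hTω).fun_sub (h'.1 T hT hTω), ?_⟩
  filter_upwards [h.2, h'.2] with t ht ht' ht₀ htω
  exact (ht ht₀ htω).sub (ht' ht₀ htω)

theorem prodMk {y w : ℝ → G} (hx : HasCaratheodoryDeriv t₀ ω x v)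
    (hy : HasCaratheodoryDeriv t₀ ω y w) :
    HasCaratheodoryDeriv t₀ ω (fun t => (x t, y t)) (fun t => (v t, w t)) := by
  simpa using (hx.clm_comp (.inl ℝ E G)).sub (hy.clm_comp (-.inr ℝ E G))

theorem pi {ι : Type*} [Fintype ι] {F : ι → Type*} [∀ i, NormedAddCommGroup (F i)]
    [∀ i, NormedSpace ℝ (F i)] {x v : ℝ → ∀ i, F i}
    (h : ∀ i, HasCaratheodoryDeriv t₀ ω (fun t => x t i) (fun t => v t i)) :
    HasCaratheodoryDeriv t₀ ω x v := by
  classical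
  simpa [Finset.univ_sum_single] using finset_sum Finset.univ
    fun i _ => (h i).clm_comp (.single ℝ F i)

theorem congr {x' v' : ℝ → E} (h : HasCaratheodoryDeriv t₀ ω x v)
    (hx : ∀ t : ℝ, t₀ ≤ t → (t : EReal) < ω → x t = x' t)
    (hv : ∀ t : ℝ, t₀ < t → (t : EReal) < ω → v t = v' t) :
    HasCaratheodoryDeriv t₀ ω x' v' := by
  refine ⟨fun T hT hTω =>
    absolutelyContinuousOnInterval_of_eqOn (h.1 T hT hTω) fun t ht => ?_, ?_⟩
  · rw [uIcc_of_le hT] at ht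
    exact hx t ht.1 (lt_of_le_of_lt (EReal.coe_le_coe ht.2) hTω)
  · filter_upwards [h.2] with t ht ht₀ htω
    rw [← hv t ht₀ htω]
    refine (ht ht₀ htω).congr_of_eventuallyEq ?_
    filter_upwards [Ioi_mem_nhds ht₀, continuous_coe_real_ereal.tendsto t (Iio_mem_nhds htω)]
      with s hs₀ hsω
    exact (hx s (le_of_lt hs₀) hsω).symm

theorem congr_deriv {v' : ℝ → E} (h : HasCaratheodoryDeriv t₀ ω x v)
    (hv : ∀ t : ℝ, t₀ < t → (t : EReal) < ω → v t = v' t) : HasCaratheodoryDeriv t₀ ω x v' :=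
  h.congr (fun _ _ _ => rfl) hv

theorem mono {ω' : EReal} (h : HasCaratheodoryDeriv t₀ ω x v) (hω : ω' ≤ ω) :
    HasCaratheodoryDeriv t₀ ω' x v := by
  refine ⟨fun T hT hTω => h.1 T hT (hTω.trans_le hω), ?_⟩
  filter_upwards [h.2] with t ht ht₀ htω
  exact ht ht₀ (htω.trans_le hω)

theorem of_seq {u : ℕ → EReal} (h : ∀ n, HasCaratheodoryDeriv t₀ (u n) x v)
    (hu : ∀ t : ℝ, (t : EReal) < ω → ∃ n, (t : EReal) < u n) : HasCaratheodoryDeriv t₀ ω x v := by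
  refine ⟨fun T hT hTω => ?_, ?_⟩
  · obtain ⟨n, hn⟩ := hu T hTω
    exact (h n).1 T hT hn
  · filter_upwards [ae_all_iff.2 fun n => (h n).2] with t ht ht₀ htω
    obtain ⟨n, hn⟩ := hu t htω
    exact ht n ht₀ hn

theorem ite_lt_of_lipschitz {x₁ x₂ v₁ v₂ : ℝ → E} {K : NNReal} {a b : ℝ}
    (h₁ : LipschitzOnWith K x₁ (Icc t₀ a)) (h₂ : LipschitzOnWith K x₂ (Icc a b))
    (ha : x₁ a = x₂ a) (hd₁ : ∀ᵐ t, t₀ < t → t < a → HasDerivAt x₁ (v₁ t) t)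
    (hd₂ : ∀ᵐ t, t ∈ Ioo a b → HasDerivAt x₂ (v₂ t) t) :
    HasCaratheodoryDeriv t₀ b (fun t => if t < a then x₁ t else x₂ t)
      (fun t => if t < a then v₁ t else v₂ t) := by
  refine ⟨fun T hT hTb => ?_, ?_⟩
  · refine LipschitzOnWith.absolutelyContinuousOnInterval (K := K)
      ((lipschitzOnWith_ite_lt h₁ h₂ ha).mono ?_)
    rw [uIcc_of_le hT]
    exact Icc_subset_Icc_right (EReal.coe_lt_coe_iff.1 hTb).le
  · filter_upwards [hd₁, hd₂, Measure.ae_ne volume a] with t hd₁ hd₂ hta ht₀ htb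
    rcases lt_or_gt_of_ne hta with hlt | hgt
    · simp only [hlt, if_true]
      refine (hd₁ ht₀ hlt).congr_of_eventuallyEq ?_
      filter_upwards [Iio_mem_nhds hlt] with s hs
      exact if_pos hs
    · simp only [not_lt.2 hgt.le, if_false]
      refine (hd₂ ⟨hgt, EReal.coe_lt_coe_iff.1 htb⟩).congr_of_eventuallyEq ?_
      filter_upwards [Ioi_mem_nhds hgt] with s hs
      exact if_neg (not_lt.2 (le_of_lt hs))

theorem continuousOn (h : HasCaratheodoryDeriv t₀ ω x v) {T : ℝ} (hT : t₀ ≤ T)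
    (hω : (T : EReal) < ω) : ContinuousOn x (Icc t₀ T) := by
  simpa only [uIcc_of_le hT] using (h.1 T hT hω).continuousOn

theorem sub_le_integral {x v φ : ℝ → ℝ} (h : HasCaratheodoryDeriv t₀ ω x v) {a b : ℝ}
    (ha : t₀ ≤ a) (hab : a ≤ b) (hb : (b : EReal) < ω) (hφ : IntervalIntegrable φ volume a b)
    (hv : ∀ t ∈ Ioo a b, v t ≤ φ t) : x b - x a ≤ ∫ t in a..b, φ t := by
  have hac : AbsolutelyContinuousOnInterval x a b := (h.1 b (ha.trans hab) hb).mono <| by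
    rw [uIcc_of_le hab, uIcc_of_le (ha.trans hab)]
    exact Icc_subset_Icc_left ha
  rw [← hac.integral_deriv_eq_sub]
  refine intervalIntegral.integral_mono_ae_restrict hab hac.intervalIntegrable_deriv hφ ?_
  rw [← restrict_Ioo_eq_restrict_Icc]
  refine (ae_restrict_iff' measurableSet_Ioo).2 ?_
  filter_upwards [h.2] with t ht htab
  rw [(ht (ha.trans_lt htab.1) (lt_trans (EReal.coe_lt_coe htab.2) hb)).deriv]
  exact hv t htab

theorem sub_le_mul {x v : ℝ → ℝ} (h : HasCaratheodoryDeriv t₀ ω x v) {a b c : ℝ}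
    (ha : t₀ ≤ a) (hab : a ≤ b) (hb : (b : EReal) < ω) (hv : ∀ t ∈ Ioo a b, v t ≤ c) :
    x b - x a ≤ c * (b - a) := by
  simpa only [intervalIntegral.integral_const, smul_eq_mul, mul_comm] using
    h.sub_le_integral ha hab hb (φ := fun _ => c) intervalIntegrable_const hv

theorem eventually_sub_le_mul {x v : ℝ → ℝ} (h : HasCaratheodoryDeriv t₀ ω x v) {a c : ℝ}
    (ha : t₀ ≤ a) (haω : (a : EReal) < ω) (hv : ∀ᶠ t in 𝓝[>] a, v t ≤ c) :
    ∀ᶠ t in 𝓝[>] a, x t - x a ≤ c * (t - a) := by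
  obtain ⟨u, hau, hu⟩ := mem_nhdsGT_iff_exists_Ioo_subset.1 hv
  filter_upwards [Ioo_mem_nhdsGT hau, mem_nhdsWithin_of_mem_nhds
    (continuous_coe_real_ereal.tendsto a (Iio_mem_nhds haω))] with t ht htω
  exact h.sub_le_mul ha ht.1.le htω fun s hs => hu ⟨hs.1, hs.2.trans ht.2⟩

theorem norm_sub_le_integral (h : HasCaratheodoryDeriv t₀ ω x v) {a b : ℝ} {φ : ℝ → ℝ}
    (ha : t₀ ≤ a) (hab : a ≤ b) (hb : (b : EReal) < ω) (hφ : IntervalIntegrable φ volume a b)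
    (hv : ∀ t ∈ Ioo a b, ‖v t‖ ≤ φ t) : ‖x b - x a‖ ≤ ∫ t in a..b, φ t := by
  obtain ⟨g, hg_norm, hg⟩ := exists_dual_vector'' ℝ (x b - x a)
  calc ‖x b - x a‖ = g (x b) - g (x a) := by rw [← map_sub, hg, RCLike.ofReal_real_eq_id, id]
    _ ≤ ∫ t in a..b, φ t := (h.clm_comp g).sub_le_integral ha hab hb hφ fun t ht =>
        ((le_abs_self _).trans (g.le_of_opNorm_le hg_norm (v t))).trans
          ((one_mul _).trans_le (hv t ht))

theorem lipschitzOnWith (h : HasCaratheodoryDeriv t₀ ω x v) {K : NNReal}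
    (hv : ∀ t : ℝ, t₀ < t → (t : EReal) < ω → ‖v t‖ ≤ K) :
    LipschitzOnWith K x {t | t₀ ≤ t ∧ (t : EReal) < ω} := by
  refine lipschitzOnWith_of_norm_sub_le fun a ha b hb hab => ?_
  simpa only [intervalIntegral.integral_const, smul_eq_mul, mul_comm] using
    h.norm_sub_le_integral ha.1 hab hb.2 (φ := fun _ => (K : ℝ)) intervalIntegrable_const
      fun t ht => hv t (ha.1.trans_lt ht.1) (lt_trans (EReal.coe_lt_coe ht.2) hb.2)

theorem eq_zero_of_integral_le_half (h : HasCaratheodoryDeriv t₀ ω x v) {Λ : ℝ → ℝ} {a b : ℝ}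
    (ha : t₀ ≤ a) (hab : a ≤ b) (hb : (b : EReal) < ω) (hxa : x a = 0)
    (hΛ : IntervalIntegrable Λ volume a b) (hΛ₀ : ∀ t, 0 ≤ Λ t)
    (hΛ_half : ∫ t in a..b, Λ t ≤ 1 / 2) (hv : ∀ t ∈ Ioo a b, ‖v t‖ ≤ Λ t * ‖x t‖) :
    x b = 0 := by
  obtain ⟨r, hr, hmax⟩ := isCompact_Icc.exists_isMaxOn (nonempty_Icc.2 hab)
    ((h.continuousOn (ha.trans hab) hb).norm.mono (Icc_subset_Icc_left ha))
  have hΛr : IntervalIntegrable Λ volume a r :=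
    hΛ.mono_set (uIcc_subset_uIcc_left (Icc_subset_uIcc hr))
  have hhalf : ‖x r‖ ≤ 1 / 2 * ‖x r‖ := calc
    ‖x r‖ = ‖x r - x a‖ := by rw [hxa, sub_zero]
    _ ≤ ∫ t in a..r, Λ t * ‖x r‖ := by
      refine h.norm_sub_le_integral ha hr.1 ((EReal.coe_le_coe hr.2).trans_lt hb)
        (hΛr.mul_const _) fun t ht => (hv t ⟨ht.1, ht.2.trans_le hr.2⟩).trans ?_
      exact mul_le_mul_of_nonneg_left (hmax ⟨ht.1.le, (ht.2.trans_le hr.2).le⟩) (hΛ₀ t)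
    _ = (∫ t in a..r, Λ t) * ‖x r‖ := intervalIntegral.integral_mul_const _ _
    _ ≤ 1 / 2 * ‖x r‖ := by
      refine mul_le_mul_of_nonneg_right (le_trans ?_ hΛ_half) (norm_nonneg _)
      exact intervalIntegral.integral_mono_interval le_rfl hr.1 hr.2 (ae_of_all _ hΛ₀) hΛ
  have hb_le : ‖x b‖ ≤ ‖x r‖ := hmax ⟨hab, le_rfl⟩
  exact norm_le_zero_iff.1 (by linarith)

-- Grönwall's argument, made local: right of a zero, the gain `∫ Λ` is below `1 / 2` for a while.
theorem eq_zero_of_forall_exists_norm_le (h : HasCaratheodoryDeriv t₀ ω x v) {T : ℝ} (hT : t₀ ≤ T)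
    (hTω : (T : EReal) < ω) (hx₀ : x t₀ = 0)
    (hv : ∀ t ∈ Ico t₀ T, x t = 0 → ∃ Λ : ℝ → ℝ, (∀ r, 0 ≤ Λ r) ∧ IntegrableOn Λ (Icc t T) ∧
      ∀ᶠ r in 𝓝[>] t, ‖v r‖ ≤ Λ r * ‖x r‖) : x T = 0 := by
  have hclosed : IsClosed ({t | x t = 0} ∩ Icc t₀ T) := by
    rw [inter_comm]
    exact (h.continuousOn hT hTω).preimage_isClosed_of_isClosed isClosed_Icc isClosed_singleton
  refine hclosed.Icc_subset_of_forall_exists_gt hx₀ ?_ (right_mem_Icc.2 hT)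
  rintro t ⟨hxt, ht⟩ u hu
  obtain ⟨Λ, hΛ₀, hΛ, hbound⟩ := hv t ht hxt
  obtain ⟨w, htw, hw⟩ := mem_nhdsGT_iff_exists_Ioo_subset.1 hbound
  obtain ⟨τ, hhalf, ⟨hτw, hτT⟩, hτu⟩ := ((eventually_integral_le ht.2 hΛ one_half_pos).and
    (inter_mem (inter_mem (Ioo_mem_nhdsGT htw) (Ioo_mem_nhdsGT ht.2))
      (Ioc_mem_nhdsGT hu))).exists
  have hτω : (τ : EReal) < ω := (EReal.coe_lt_coe hτT.2).trans hTω
  refine ⟨τ, h.eq_zero_of_integral_le_half ht.1 hτT.1.le hτω hxt ?_ hΛ₀ hhalf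
    fun r hr => hw ⟨hr.1, hr.2.trans hτw.2⟩, hτu⟩
  rw [intervalIntegrable_iff_integrableOn_Icc_of_le hτT.1.le]
  exact hΛ.mono_set (Icc_subset_Icc_right hτT.2.le)

end HasCaratheodoryDeriv

/-! ### Carathéodory's existence theorem -/

theorem exists_subseq_tendsto_of_equicontinuous {X E : Type*} [TopologicalSpace X] [CompactSpace X]
    [MetricSpace E] {s : Set E} (hs : IsCompact s) {f : ℕ → X → E} (hf : Equicontinuous f)
    (hfs : ∀ n t, f n t ∈ s) :
    ∃ (x : X → E) (φ : ℕ → ℕ), StrictMono φ ∧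
      ∀ t, Tendsto (fun n => f (φ n) t) atTop (𝓝 (x t)) := by
  let F : ℕ → BoundedContinuousFunction X E := fun n =>
    BoundedContinuousFunction.mkOfCompact ⟨f n, hf.continuous n⟩
  have hcompact : IsCompact (closure (range F)) := by
    refine BoundedContinuousFunction.arzela_ascoli s hs _ ?_ ?_
    · rintro _ t ⟨n, rfl⟩
      exact hfs n t
    · intro t U hU
      filter_upwards [hf t U hU] with t' ht'
      rintro ⟨_, n, rfl⟩
      exact ht' n
  obtain ⟨x, -, φ, hφ, hx⟩ := hcompact.tendsto_subseq fun n => subset_closure (mem_range_self n)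
  exact ⟨x, φ, hφ, fun t =>
    ((BoundedContinuousFunction.lipschitz_eval_const t).continuous.tendsto x).comp hx⟩

theorem intervalIntegrable_of_norm_le {E : Type*} [NormedAddCommGroup E] {f : ℝ → E} {M : ℝ}
    (hf : AEStronglyMeasurable f volume) (hM : ∀ t, ‖f t‖ ≤ M) (a b : ℝ) :
    IntervalIntegrable f volume a b :=
  (intervalIntegrable_const (c := M)).mono_fun hf.restrict
    (Eventually.of_forall fun t => (hM t).trans (le_abs_self M))

section Euler

variable {E : Type*} [NormedAddCommGroup E] [NormedSpace ℝ E]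

theorem lipschitzWith_add_integral {f : ℝ → E} (hf : AEStronglyMeasurable f volume) {M : NNReal}
    (hM : ∀ t, ‖f t‖ ≤ M) (a : ℝ) (x₀ : E) :
    LipschitzWith M fun t => x₀ + ∫ s in a..t, f s := by
  refine LipschitzWith.of_dist_le_mul fun s t => ?_
  have hint := intervalIntegrable_of_norm_le hf hM
  rw [dist_eq_norm, add_sub_add_left_eq_sub,
    intervalIntegral.integral_interval_sub_left (hint a s) (hint a t), dist_comm, Real.dist_eq,
    abs_sub_comm]
  exact intervalIntegral.norm_integral_le_of_norm_le_const fun u _ => hM u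

/-- The values at the grid points `a + k / (n + 1)` of the Euler polygon of `x' = g(t, x)`,
`x(a) = x₀`, where the field is frozen in `x` but integrated exactly in `t`. -/
noncomputable def eulerNode (g : ℝ → E → E) (a : ℝ) (x₀ : E) (n : ℕ) : ℕ → E
  | 0 => x₀
  | k + 1 => eulerNode g a x₀ n k +
      ∫ s in (a + k / (n + 1))..(a + (k + 1 : ℕ) / (n + 1)), g s (eulerNode g a x₀ n k)

/-- The step function through the values `eulerNode`: the state at which the field is frozen. -/
noncomputable def eulerStep (g : ℝ → E → E) (a : ℝ) (x₀ : E) (n : ℕ) (s : ℝ) : E :=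
  eulerNode g a x₀ n ⌊(s - a) * (n + 1)⌋₊

/-- The Euler polygon of `x' = g(t, x)`, `x(a) = x₀` with mesh `1 / (n + 1)`. -/
noncomputable def eulerPolygon (g : ℝ → E → E) (a : ℝ) (x₀ : E) (n : ℕ) (t : ℝ) : E :=
  x₀ + ∫ s in a..t, g s (eulerStep g a x₀ n s)

variable {g : ℝ → E → E} {M : NNReal} {a b : ℝ} {x₀ : E}

theorem aestronglyMeasurable_comp_eulerStep
    (hmeas : ∀ x, AEStronglyMeasurable (fun t => g t x) volume) (n : ℕ) :
    AEStronglyMeasurable (fun s => g s (eulerStep g a x₀ n s)) volume := by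
  have hfloor : Measurable fun s : ℝ => ⌊(s - a) * ((n : ℝ) + 1)⌋₊ :=
    Nat.measurable_floor.comp ((measurable_id.sub_const a).mul_const _)
  have hcover : (⋃ k : ℕ, (fun s : ℝ => ⌊(s - a) * ((n : ℝ) + 1)⌋₊) ⁻¹' {k}) = univ := by
    ext s; simp
  rw [← Measure.restrict_univ (μ := volume), ← hcover, aestronglyMeasurable_iUnion_iff]
  intro k
  refine ((hmeas (eulerNode g a x₀ n k)).restrict).congr ?_
  refine (ae_restrict_iff' (hfloor (measurableSet_singleton k))).2 (Eventually.of_forall ?_)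
  rintro s rfl
  rfl

theorem eulerStep_eq_eulerNode {n k : ℕ} {s : ℝ}
    (hs : s ∈ Ico (a + k / (n + 1)) (a + (k + 1 : ℕ) / (n + 1))) :
    eulerStep g a x₀ n s = eulerNode g a x₀ n k := by
  have hn : (0 : ℝ) < n + 1 := by positivity
  have hlow : (k : ℝ) ≤ (s - a) * (n + 1) := by
    rw [← div_le_iff₀ hn]; linarith [hs.1]
  have hupp : (s - a) * (n + 1) < k + 1 := by
    rw [← lt_div_iff₀ hn, ← Nat.cast_succ]; linarith [hs.2]
  rw [eulerStep, (Nat.floor_eq_iff ((Nat.cast_nonneg k).trans hlow)).2 ⟨hlow, hupp⟩]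

theorem eulerPolygon_grid (hmeas : ∀ x, AEStronglyMeasurable (fun t => g t x) volume)
    (hM : ∀ t x, ‖g t x‖ ≤ M) (n k : ℕ) :
    eulerPolygon g a x₀ n (a + k / (n + 1)) = eulerNode g a x₀ n k := by
  have hint := intervalIntegrable_of_norm_le
    (aestronglyMeasurable_comp_eulerStep (a := a) (x₀ := x₀) hmeas n) (fun t => hM t _)
  induction k with
  | zero => simp [eulerPolygon, eulerNode]
  | succ k ih =>
    have hle : a + (k : ℝ) / (n + 1) ≤ a + ((k + 1 : ℕ) : ℝ) / (n + 1) := by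
      gcongr
      exact Nat.le_succ k
    have hstep : (∫ s in (a + (k : ℝ) / (n + 1))..(a + ((k + 1 : ℕ) : ℝ) / (n + 1)),
          g s (eulerStep g a x₀ n s)) =
        ∫ s in (a + (k : ℝ) / (n + 1))..(a + ((k + 1 : ℕ) : ℝ) / (n + 1)),
          g s (eulerNode g a x₀ n k) := by
      refine intervalIntegral.integral_congr_ae ?_
      filter_upwards [Measure.ae_ne volume (a + ((k + 1 : ℕ) : ℝ) / (n + 1))] with s hs hmem
      rw [uIoc_of_le hle] at hmem
      rw [eulerStep_eq_eulerNode ⟨hmem.1.le, lt_of_le_of_ne hmem.2 hs⟩]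
    rw [eulerNode, ← hstep, ← ih, eulerPolygon, eulerPolygon, add_assoc,
      intervalIntegral.integral_add_adjacent_intervals (hint a _) (hint _ _)]

theorem lipschitzWith_eulerPolygon (hmeas : ∀ x, AEStronglyMeasurable (fun t => g t x) volume)
    (hM : ∀ t x, ‖g t x‖ ≤ M) (n : ℕ) : LipschitzWith M (eulerPolygon g a x₀ n) :=
  lipschitzWith_add_integral (aestronglyMeasurable_comp_eulerStep hmeas n) (fun t => hM t _) a x₀

theorem dist_eulerStep_le (hmeas : ∀ x, AEStronglyMeasurable (fun t => g t x) volume)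
    (hM : ∀ t x, ‖g t x‖ ≤ M) (n : ℕ) {s : ℝ} (hs : a ≤ s) :
    dist (eulerStep g a x₀ n s) (eulerPolygon g a x₀ n s) ≤ M * (1 / (n + 1)) := by
  have hn : (0 : ℝ) < n + 1 := by positivity
  set k := ⌊(s - a) * ((n : ℝ) + 1)⌋₊ with hk
  have hlow : (k : ℝ) / (n + 1) ≤ s - a := by
    rw [div_le_iff₀ hn]
    exact Nat.floor_le (mul_nonneg (sub_nonneg.2 hs) hn.le)
  have hupp : s - a ≤ (k : ℝ) / (n + 1) + 1 / (n + 1) := by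
    rw [← add_div, le_div_iff₀ hn]
    exact (Nat.lt_floor_add_one _).le
  rw [eulerStep, ← hk, ← eulerPolygon_grid hmeas hM]
  refine ((lipschitzWith_eulerPolygon hmeas hM n).dist_le_mul _ _).trans
    (mul_le_mul_of_nonneg_left ?_ M.2)
  rw [dist_comm, Real.dist_eq, abs_of_nonneg (by linarith)]
  linarith

theorem exists_subseq_tendsto_eulerPolygon [FiniteDimensional ℝ E]
    (hmeas : ∀ x, AEStronglyMeasurable (fun t => g t x) volume)
    (hM : ∀ t x, ‖g t x‖ ≤ M) (hab : a ≤ b) (x₀ : E) :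
    ∃ (x : ℝ → E) (φ : ℕ → ℕ), StrictMono φ ∧
      ∀ t ∈ Icc a b, Tendsto (fun n => eulerPolygon g a x₀ (φ n) t) atTop (𝓝 (x t)) := by
  have : ProperSpace E := FiniteDimensional.proper ℝ E
  have hlip : ∀ n, LipschitzWith M (eulerPolygon g a x₀ n) := lipschitzWith_eulerPolygon hmeas hM
  have hequi : Equicontinuous fun n (t : Icc a b) => eulerPolygon g a x₀ n t :=
    (LipschitzWith.uniformEquicontinuous (fun n (t : Icc a b) => _) M fun n =>
      LipschitzWith.of_dist_le_mul fun s t => (hlip n).dist_le_mul s t).equicontinuous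
  obtain ⟨x, φ, hφ, hx⟩ := exists_subseq_tendsto_of_equicontinuous
    (isCompact_closedBall x₀ (M * (b - a))) hequi
    fun n t => by
      have hstart : eulerPolygon g a x₀ n a = x₀ := by simp [eulerPolygon]
      calc dist (eulerPolygon g a x₀ n t) x₀
          = dist (eulerPolygon g a x₀ n t) (eulerPolygon g a x₀ n a) := by rw [hstart]
        _ ≤ M * dist (t : ℝ) a := (hlip n).dist_le_mul _ _
        _ ≤ M * (b - a) := by
            rw [Real.dist_eq, abs_of_nonneg (sub_nonneg.2 t.2.1)]
            gcongr
            exact t.2.2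
  refine ⟨IccExtend hab x, φ, hφ, fun t ht => ?_⟩
  rw [IccExtend_of_mem hab x ht]
  exact hx ⟨t, ht⟩

theorem exists_lipschitzWith_hasDerivAt_of_bounded [FiniteDimensional ℝ E]
    (hmeas : ∀ x, AEStronglyMeasurable (fun t => g t x) volume)
    (hcont : ∀ t, Continuous (g t)) (hM : ∀ t x, ‖g t x‖ ≤ M) (hab : a ≤ b) (x₀ : E) :
    ∃ x : ℝ → E, x a = x₀ ∧ LipschitzWith M x ∧
      ∀ᵐ t, t ∈ Ioo a b → HasDerivAt x (g t (x t)) t := by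
  have : CompleteSpace E := FiniteDimensional.complete ℝ E
  obtain ⟨x, φ, hφ, hx⟩ := exists_subseq_tendsto_eulerPolygon hmeas hM hab x₀
  have hstep : ∀ t ∈ Icc a b, Tendsto (fun n => g t (eulerStep g a x₀ (φ n) t)) atTop
      (𝓝 (g t (x t))) := by
    refine fun t ht => ((hcont t).tendsto _).comp ((tendsto_iff_of_dist ?_).2 (hx t ht))
    refine squeeze_zero (fun _ => dist_nonneg) (fun n => dist_eulerStep_le hmeas hM (φ n) ht.1) ?_
    simpa using ((tendsto_one_div_add_atTop_nhds_zero_nat (𝕜 := ℝ)).comp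
      hφ.tendsto_atTop).const_mul (M : ℝ)
  let G : ℝ → E := (Icc a b).indicator fun t => g t (x t)
  have hG : AEStronglyMeasurable G volume := by
    refine aestronglyMeasurable_of_tendsto_ae atTop
      (f := fun n => (Icc a b).indicator fun t => g t (eulerStep g a x₀ (φ n) t))
      (fun n => (aestronglyMeasurable_comp_eulerStep hmeas (φ n)).indicator measurableSet_Icc)
      (Eventually.of_forall fun t => ?_)
    by_cases ht : t ∈ Icc a b
    · simpa only [G, indicator_of_mem ht] using hstep t ht
    · simp only [G, indicator_of_notMem ht, tendsto_const_nhds]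
  have hGM : ∀ t, ‖G t‖ ≤ M := fun t =>
    (norm_indicator_le_norm_self _ _).trans (hM t _)
  have hx_eq : ∀ t ∈ Icc a b, x t = x₀ + ∫ s in a..t, G s := by
    intro t ht
    refine tendsto_nhds_unique (hx t ht) (Tendsto.const_add x₀ ?_)
    refine intervalIntegral.tendsto_integral_filter_of_dominated_convergence (fun _ => (M : ℝ))
      (Eventually.of_forall fun n => (aestronglyMeasurable_comp_eulerStep hmeas (φ n)).restrict)
      (Eventually.of_forall fun n => Eventually.of_forall fun s _ => hM s _)
      intervalIntegrable_const (Eventually.of_forall fun s hs => ?_)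
    rw [uIoc_of_le ht.1] at hs
    have hs' : s ∈ Icc a b := ⟨hs.1.le, hs.2.trans ht.2⟩
    simpa only [G, indicator_of_mem hs'] using hstep s hs'
  refine ⟨fun t => x₀ + ∫ s in a..t, G s, by simp, lipschitzWith_add_integral hG hGM a x₀, ?_⟩
  filter_upwards [(intervalIntegrable_of_norm_le hG hGM a b).ae_hasDerivAt_integral] with t ht htab
  have ht_mem : t ∈ Icc a b := Ioo_subset_Icc_self htab
  have hderiv := (ht (by rwa [uIcc_of_le hab]) a left_mem_uIcc).const_add x₀
  rw [← hx_eq t ht_mem]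
  simpa only [G, indicator_of_mem ht_mem] using hderiv

theorem exists_continuous_retraction_closedBall (x₀ : E) {r : ℝ} (hr : 0 < r) :
    ∃ π : E → E, Continuous π ∧ (∀ x, π x ∈ Metric.closedBall x₀ r) ∧
      ∀ x ∈ Metric.closedBall x₀ r, π x = x := by
  have hmax : ∀ x, 0 < max r ‖x - x₀‖ := fun x => hr.trans_le (le_max_left _ _)
  have hscale : Continuous fun x => r / max r ‖x - x₀‖ :=
    continuous_const.div (by fun_prop) fun x => (hmax x).ne'
  refine ⟨fun x => x₀ + (r / max r ‖x - x₀‖) • (x - x₀), by fun_prop, fun x => ?_, fun x hx => ?_⟩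
  · rw [mem_closedBall_iff_norm, add_sub_cancel_left, norm_smul, Real.norm_of_nonneg
      (div_nonneg hr.le (hmax x).le), div_mul_eq_mul_div, div_le_iff₀ (hmax x)]
    exact mul_le_mul_of_nonneg_left (le_max_right _ _) hr.le
  · simp only [max_eq_left (mem_closedBall_iff_norm.1 hx), div_self hr.ne', one_smul,
      add_sub_cancel]

theorem exists_lipschitzWith_hasDerivAt_of_bounded_closedBall [FiniteDimensional ℝ E] {r : ℝ}
    (hab : a < b) (hr : 0 < r)
    (hmeas : ∀ x ∈ Metric.closedBall x₀ r,
      AEStronglyMeasurable (fun t => g t x) (volume.restrict (Icc a b)))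
    (hcont : ∀ t ∈ Icc a b, ContinuousOn (g t) (Metric.closedBall x₀ r))
    (hM : ∀ t ∈ Icc a b, ∀ x ∈ Metric.closedBall x₀ r, ‖g t x‖ ≤ M) :
    ∃ b' ∈ Ioc a b, ∃ x : ℝ → E, x a = x₀ ∧ LipschitzWith M x ∧
      (∀ t ∈ Icc a b', x t ∈ Metric.closedBall x₀ r) ∧
      ∀ᵐ t, t ∈ Ioo a b' → HasDerivAt x (g t (x t)) t := by
  obtain ⟨π, hπ, hπ_mem, hπ_eq⟩ := exists_continuous_retraction_closedBall x₀ hr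
  obtain ⟨x, hxa, hx, hderiv⟩ := exists_lipschitzWith_hasDerivAt_of_bounded (M := M)
    (g := fun t x => (Icc a b).indicator (fun t => g t (π x)) t)
    (fun x => (aestronglyMeasurable_indicator_iff measurableSet_Icc).2 (hmeas _ (hπ_mem x)))
    (fun t => by
      by_cases ht : t ∈ Icc a b
      · simp only [indicator_of_mem ht]
        exact (hcont t ht).comp_continuous hπ hπ_mem
      · simp only [indicator_of_notMem ht, continuous_const])
    (fun t x => by
      by_cases ht : t ∈ Icc a b
      · simpa only [indicator_of_mem ht] using hM t ht _ (hπ_mem x)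
      · simp only [indicator_of_notMem ht, norm_zero, NNReal.zero_le_coe])
    hab.le x₀
  have hM₁ : (0 : ℝ) < M + 1 := by positivity
  have hball : ∀ t ∈ Icc a (min b (a + r / (M + 1))), x t ∈ Metric.closedBall x₀ r := by
    intro t ht
    have hta : dist t a ≤ r / (M + 1) := by
      rw [Real.dist_eq, abs_of_nonneg (sub_nonneg.2 ht.1)]
      exact sub_le_iff_le_add'.2 (ht.2.trans (min_le_right _ _))
    calc dist (x t) x₀ ≤ M * dist t a := hxa ▸ hx.dist_le_mul t a
      _ ≤ (M + 1) * (r / (M + 1)) :=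
        mul_le_mul (le_add_of_nonneg_right one_pos.le) hta dist_nonneg hM₁.le
      _ = r := mul_div_cancel₀ _ hM₁.ne'
  refine ⟨min b (a + r / (M + 1)), ⟨lt_min hab (lt_add_of_pos_right a (div_pos hr hM₁)),
    min_le_left _ _⟩, x, hxa, hx, hball, ?_⟩
  filter_upwards [hderiv] with t ht htab
  have htb : t ∈ Ioo a b := ⟨htab.1, htab.2.trans_le (min_le_left _ _)⟩
  simpa only [indicator_of_mem (Ioo_subset_Icc_self htb),
    hπ_eq _ (hball t (Ioo_subset_Icc_self htab))] using ht htb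

end Euler

/-! ### Coupling functions with poles -/

theorem exists_forall_le_one_sub_mul {ι : Type*} [Finite ι] {a b : ι → ℝ} (h : ∀ i, a i < b i) :
    ∃ ε ∈ Ioo (0 : ℝ) 1, ∀ i, a i ≤ (1 - ε) * b i := by
  have hlim : ∀ᶠ ε in 𝓝[>] (0 : ℝ), ∀ i, a i ≤ (1 - ε) * b i := by
    refine eventually_all.2 fun i => ?_
    have hcont : Tendsto (fun ε : ℝ => (1 - ε) * b i) (𝓝[>] 0) (𝓝 ((1 - 0) * b i)) :=
      (Continuous.tendsto (by fun_prop) 0).mono_left nhdsWithin_le_nhds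
    rw [sub_zero, one_mul] at hcont
    exact (hcont.eventually (lt_mem_nhds (h i))).mono fun ε => le_of_lt
  obtain ⟨ε, hε, hε_mem⟩ := (hlim.and (Ioo_mem_nhdsGT zero_lt_one)).exists
  exact ⟨ε, hε_mem, hε⟩

theorem div_mem_Ioo_of_abs_lt {a b : ℝ} (h : |a| < b) : a / b ∈ Ioo (-1 : ℝ) 1 := by
  have hb : 0 < b := (abs_nonneg a).trans_lt h
  rwa [mem_Ioo, ← abs_lt, abs_div, abs_of_pos hb, div_lt_one hb]

/-- A coupling function: continuous on `(-1, 1)` with poles of opposite sign at the endpoints. -/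
structure IsPolarCoupling (m : ℝ → ℝ) : Prop where
  continuousOn : ContinuousOn m (Ioo (-1) 1)
  tendsto_right : Tendsto m (𝓝[<] 1) atTop
  tendsto_left : Tendsto m (𝓝[>] (-1)) atBot

/-- Quantifies that `m` is at most `K` at distance `δ` from its positive pole and at least `-K` at
distance `δ` from its negative pole. -/
def BoundedAwayFromPoles (m : ℝ → ℝ) (δ K : ℝ) : Prop :=
  ∀ s ∈ Ioo (-1 : ℝ) 1, (s ≤ 1 - δ → m s ≤ K) ∧ (-(1 - δ) ≤ s → -K ≤ m s)

/-- Quantifies that `m` is at least `R` within `η` of its positive pole and at most `-R` within `η`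
of its negative pole. -/
def LargeNearPoles (m : ℝ → ℝ) (η R : ℝ) : Prop :=
  ∀ s ∈ Ioo (-1 : ℝ) 1, (1 - η ≤ s → R ≤ m s) ∧ (s ≤ -(1 - η) → m s ≤ -R)

namespace IsPolarCoupling

variable {m : ℝ → ℝ}

theorem eventually_boundedAwayFromPoles (hm : IsPolarCoupling m) {δ : ℝ} (hδ : 0 < δ) :
    ∀ᶠ K in atTop, BoundedAwayFromPoles m δ K := by
  obtain ⟨u, hu, hmu⟩ := mem_nhdsGT_iff_exists_Ioo_subset.1
    (hm.tendsto_left.eventually (eventually_le_atBot 0))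
  obtain ⟨w, hw, hmw⟩ := mem_nhdsLT_iff_exists_Ioo_subset.1
    (hm.tendsto_right.eventually (eventually_ge_atTop 0))
  simp only [mem_Ioi, mem_Iio] at hu hw
  obtain ⟨A, hA⟩ := (isCompact_Icc (a := u) (b := 1 - δ)).exists_bound_of_continuousOn
    (hm.continuousOn.mono fun s hs => ⟨by linarith [hs.1], by linarith [hs.2]⟩)
  obtain ⟨B, hB⟩ := (isCompact_Icc (a := -(1 - δ)) (b := w)).exists_bound_of_continuousOn
    (hm.continuousOn.mono fun s hs => ⟨by linarith [hs.1], by linarith [hs.2]⟩)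
  filter_upwards [eventually_ge_atTop A, eventually_ge_atTop B, eventually_ge_atTop 0]
    with K hAK hBK hK
  refine fun s hs => ⟨fun hsδ => ?_, fun hsδ => ?_⟩
  · rcases lt_or_ge s u with hsu | hsu
    · exact le_trans (hmu ⟨hs.1, hsu⟩) hK
    · exact ((le_abs_self _).trans (hA s ⟨hsu, hsδ⟩)).trans hAK
  · rcases lt_or_ge w s with hsw | hsw
    · exact (neg_nonpos.2 hK).trans (hmw ⟨hsw, hs.2⟩)
    · exact neg_le.1 (((neg_le_abs (m s)).trans (hB s ⟨hsδ, hsw⟩)).trans hBK)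

theorem eventually_largeNearPoles (hm : IsPolarCoupling m) (R : ℝ) :
    ∀ᶠ η in 𝓝[>] (0 : ℝ), LargeNearPoles m η R := by
  obtain ⟨u, hu, hmu⟩ := mem_nhdsGT_iff_exists_Ioo_subset.1
    (hm.tendsto_left.eventually (eventually_le_atBot (-R)))
  obtain ⟨w, hw, hmw⟩ := mem_nhdsLT_iff_exists_Ioo_subset.1
    (hm.tendsto_right.eventually (eventually_ge_atTop R))
  simp only [mem_Ioi, mem_Iio] at hu hw
  have hηu : ∀ᶠ η in 𝓝[>] (0 : ℝ), η < u + 1 :=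
    mem_nhdsWithin_of_mem_nhds (Iio_mem_nhds (by linarith))
  have hηw : ∀ᶠ η in 𝓝[>] (0 : ℝ), η < 1 - w :=
    mem_nhdsWithin_of_mem_nhds (Iio_mem_nhds (by linarith))
  filter_upwards [hηu, hηw] with η hηu hηw
  exact fun s hs => ⟨fun h => hmw ⟨by linarith, hs.2⟩, fun h => hmu ⟨hs.1, by linarith⟩⟩

end IsPolarCoupling

theorem exists_threshold {ι : Type*} [Finite ι] {μ : ι → ℝ → ℝ} (hμ : ∀ i, IsPolarCoupling (μ i))
    (A B : ℝ) {δ ε₀ : ℝ} (hδ : 0 < δ) (hε₀ : 0 < ε₀) :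
    ∃ η ∈ Ioc 0 ε₀, ∃ K, 0 ≤ K ∧ (∀ i, BoundedAwayFromPoles (μ i) δ K) ∧
      ∀ i, LargeNearPoles (μ i) η (A + B * K) := by
  obtain ⟨K, hK, hK0⟩ := ((eventually_all.2 fun i =>
    (hμ i).eventually_boundedAwayFromPoles hδ).and (eventually_ge_atTop 0)).exists
  obtain ⟨η, hη, hη_mem⟩ := ((eventually_all.2 fun i =>
    (hμ i).eventually_largeNearPoles (A + B * K)).and (Ioc_mem_nhdsGT hε₀)).exists
  exact ⟨η, hη_mem, K, hK0, hK, hη⟩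

-- The thresholds are chosen downwards from `ε (n + 1) = ε₀`, each after the bound `K` below the
-- next one is known.
theorem exists_threshold_scale {ι : Type*} [Finite ι] {μ : ι → ℝ → ℝ}
    (hμ : ∀ i, IsPolarCoupling (μ i)) (A B : ℝ) (n : ℕ) {ε₀ : ℝ} (hε₀ : 0 < ε₀) :
    ∃ ε : ℕ → ℝ, (∀ h, ε h ∈ Ioc 0 ε₀) ∧ ∀ h ≤ n, ∃ K, 0 ≤ K ∧
      (∀ i, BoundedAwayFromPoles (μ i) (ε (h + 1)) K) ∧
      ∀ i, LargeNearPoles (μ i) (ε h) (A + B * K) := by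
  choose! next hnext_mem hnext using fun δ (hδ : δ ∈ Ioc 0 ε₀) =>
    exists_threshold hμ A B hδ.1 hε₀
  have hmem : ∀ k, next^[k] ε₀ ∈ Ioc 0 ε₀ := by
    intro k
    induction k with
    | zero => exact ⟨hε₀, le_rfl⟩
    | succ k ih =>
      rw [Function.iterate_succ_apply']
      exact hnext_mem _ ih
  refine ⟨fun h => next^[n + 1 - h] ε₀, fun h => hmem _, fun h hh => ?_⟩
  have hindex : n + 1 - h = (n + 1 - (h + 1)) + 1 := by omega
  simpa only [hindex, Function.iterate_succ_apply'] using hnext _ (hmem (n + 1 - (h + 1)))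

/-! ### Funnel trees -/

section FunnelTree

variable {V : Type*} [DecidableEq V] {G : SimpleGraph V} {ψ : V → V → ℝ → ℝ} {ε : ℕ → ℝ}

/-- `FunnelTree G ψ ε U θ`: the vertex set `U` is obtained from one vertex by attaching vertices
successively along edges, and `θ` is the sum of the funnels of these edges, the edge of the
`h`-th vertex being shrunk by the factor `1 - ε h`. The widths `θ` serve as barriers for the
spread of a funnel coupled network over `U`. -/
inductive FunnelTree (G : SimpleGraph V) (ψ : V → V → ℝ → ℝ) (ε : ℕ → ℝ) :
    Finset V → (ℝ → ℝ) → Prop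
  | single (r : V) : FunnelTree G ψ ε {r} fun _ => 0
  | attach {U : Finset V} {θ : ℝ → ℝ} {a c : V} : FunnelTree G ψ ε U θ → c ∈ U → a ∉ U →
      G.Adj a c → FunnelTree G ψ ε (insert a U) fun t => θ t + (1 - ε (U.card + 1)) * ψ a c t

/-- All barriers given by funnel trees are respected by `x` at time `t`. -/
def IsTreeBounded (G : SimpleGraph V) (ψ : V → V → ℝ → ℝ) (ε : ℕ → ℝ) (t : ℝ) (x : V → ℝ) : Prop :=
  ∀ U θ, FunnelTree G ψ ε U θ → ∀ a ∈ U, ∀ b ∈ U, x a - x b ≤ θ t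

theorem IsTreeBounded.neg {t : ℝ} {x : V → ℝ} (h : IsTreeBounded G ψ ε t x) :
    IsTreeBounded G ψ ε t (-x) := fun U θ hU a ha b hb => by
  simpa only [Pi.neg_apply, neg_sub_neg] using h U θ hU b hb a ha

namespace FunnelTree

variable {U : Finset V} {θ : ℝ → ℝ} {t : ℝ}

theorem card_pos (h : FunnelTree G ψ ε U θ) : 0 < U.card := by
  cases h with
  | single _ => exact Finset.card_pos.2 (Finset.singleton_nonempty _)
  | attach _ _ _ _ => exact Finset.card_pos.2 (Finset.insert_nonempty _ _)

theorem finite_card_le [Finite V] (k : ℕ) :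
    {q : Finset V × (ℝ → ℝ) | FunnelTree G ψ ε q.1 q.2 ∧ q.1.card ≤ k}.Finite := by
  induction k with
  | zero =>
    refine Set.finite_empty.subset ?_
    rintro q ⟨h, hk⟩
    exact absurd h.card_pos (by omega)
  | succ k ih =>
    let single (r : V) : Finset V × (ℝ → ℝ) := ({r}, fun _ => 0)
    let attach (w : (Finset V × (ℝ → ℝ)) × V × V) : Finset V × (ℝ → ℝ) :=
      (insert w.2.1 w.1.1, fun t => w.1.2 t + (1 - ε (w.1.1.card + 1)) * ψ w.2.1 w.2.2 t)
    refine ((Set.finite_range single).union ((ih.prod Set.finite_univ).image attach)).subset ?_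
    rintro ⟨U, θ⟩ ⟨h, hk⟩
    cases h with
    | single r => exact Or.inl ⟨r, rfl⟩
    | @attach U θ a c h _ ha _ =>
      refine Or.inr ⟨((U, θ), (a, c)), ⟨⟨h, ?_⟩, mem_univ _⟩, rfl⟩
      exact Nat.le_of_succ_le_succ ((Finset.card_insert_of_notMem ha).symm.trans_le hk)

theorem finite [Finite V] : {q : Finset V × (ℝ → ℝ) | FunnelTree G ψ ε q.1 q.2}.Finite :=
  have := Fintype.ofFinite V
  (finite_card_le (Fintype.card V)).subset fun _ hq => ⟨hq, Finset.card_le_univ _⟩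

theorem nonneg (hε : ∀ h, ε h ∈ Ioo (0 : ℝ) 1) (hψ : ∀ i j, G.Adj i j → 0 < ψ i j t)
    (h : FunnelTree G ψ ε U θ) : 0 ≤ θ t := by
  induction h with
  | single _ => exact le_rfl
  | attach _ _ _ hac ih =>
    exact add_nonneg ih (mul_nonneg (sub_nonneg.2 (hε _).2.le) (hψ _ _ hac).le)

theorem continuousOn {s : Set ℝ} (hψ : ∀ i j, G.Adj i j → ContinuousOn (ψ i j) s)
    (h : FunnelTree G ψ ε U θ) : ContinuousOn θ s := by
  induction h with
  | single _ => exact continuousOn_const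
  | attach _ _ _ hac ih => exact ih.add (continuousOn_const.mul (hψ _ _ hac))

theorem sub_le {s B : ℝ} (hε : ∀ h, ε h ∈ Ioo (0 : ℝ) 1) (hst : s ≤ t) (hB : 0 ≤ B)
    (hψ : ∀ i j, G.Adj i j → ψ i j s - ψ i j t ≤ B * (t - s)) (h : FunnelTree G ψ ε U θ) :
    θ s - θ t ≤ U.card * (B * (t - s)) := by
  have hBst : 0 ≤ B * (t - s) := mul_nonneg hB (sub_nonneg.2 hst)
  induction h with
  | single _ => simpa using hBst
  | @attach U θ a c _ _ ha hac ih =>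
    have hfactor := hε (U.card + 1)
    have hedge : (1 - ε (U.card + 1)) * (ψ a c s - ψ a c t) ≤ B * (t - s) :=
      (mul_le_mul_of_nonneg_left (hψ _ _ hac) (sub_nonneg.2 hfactor.2.le)).trans
        (mul_le_of_le_one_left hBst (sub_le_self _ hfactor.1.le))
    rw [Finset.card_insert_of_notMem ha]
    push_cast
    linarith

end FunnelTree

theorem isTreeBounded_of_margin {t ε₀ : ℝ} {x : V → ℝ} (hε : ∀ h, ε h ∈ Ioc 0 ε₀) (hε₀ : ε₀ < 1)
    (hψ : ∀ i j, G.Adj i j → 0 < ψ i j t)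
    (hx : ∀ i j, G.Adj i j → |x j - x i| ≤ (1 - ε₀) * ψ i j t) : IsTreeBounded G ψ ε t x := by
  intro U θ h
  induction h with
  | single r =>
    intro a ha b hb
    rw [Finset.mem_singleton.1 ha, Finset.mem_singleton.1 hb, sub_self]
  | @attach U θ a c h hc ha hac ih =>
    have hedge : |x c - x a| ≤ (1 - ε (U.card + 1)) * ψ a c t := (hx _ _ hac).trans
      (mul_le_mul_of_nonneg_right (sub_le_sub_left (hε _).2 1) (hψ _ _ hac).le)
    have hedge_nonneg := (abs_nonneg _).trans hedge
    have hθ_nonneg := h.nonneg (fun h => ⟨(hε h).1, (hε h).2.trans_lt hε₀⟩) hψ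
    intro p hp q hq
    rcases Finset.mem_insert.1 hp with rfl | hpU <;> rcases Finset.mem_insert.1 hq with rfl | hqU
    · linarith
    · linarith [ih c hc q hqU, (abs_le.1 hedge).1]
    · linarith [ih p hpU c hc, (abs_le.1 hedge).2]
    · linarith [ih p hpU q hqU]

namespace FunnelTree

variable {U : Finset V} {θ : ℝ → ℝ} {t : ℝ} {x : V → ℝ} {a b : V}

theorem div_le_of_sub_eq (hε : ∀ h, ε h ∈ Ioo (0 : ℝ) 1) (hψ : ∀ i j, G.Adj i j → 0 < ψ i j t)
    (hsymm : ∀ i j, G.Adj i j → ψ i j t = ψ j i t) (hx : IsTreeBounded G ψ ε t x)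
    (h : FunnelTree G ψ ε U θ) (ha : a ∈ U) (hb : b ∈ U) (heq : x a - x b = θ t) {c : V}
    (hc : G.Adj a c) : (x c - x a) / ψ a c t ≤ 1 - ε (U.card + 1) := by
  rw [div_le_iff₀ (hψ _ _ hc)]
  by_cases hcU : c ∈ U
  · have hpos := mul_nonneg (sub_nonneg.2 (hε (U.card + 1)).2.le) (hψ _ _ hc).le
    linarith [hx U θ h c hcU b hb]
  · rw [hsymm _ _ hc]
    linarith [hx _ _ (h.attach ha hcU hc.symm) c (Finset.mem_insert_self _ _) b
      (Finset.mem_insert_of_mem hb)]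

theorem le_div_of_sub_eq (hε : ∀ h, ε h ∈ Ioo (0 : ℝ) 1) (hψ : ∀ i j, G.Adj i j → 0 < ψ i j t)
    (hsymm : ∀ i j, G.Adj i j → ψ i j t = ψ j i t) (hx : IsTreeBounded G ψ ε t x)
    (h : FunnelTree G ψ ε U θ) (ha : a ∈ U) (hb : b ∈ U) (heq : x a - x b = θ t) {c : V}
    (hc : G.Adj b c) : -(1 - ε (U.card + 1)) ≤ (x c - x b) / ψ b c t := by
  have hneg := h.div_le_of_sub_eq hε hψ hsymm hx.neg hb ha
    (by simpa only [Pi.neg_apply, neg_sub_neg] using heq) hc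
  rwa [Pi.neg_apply, Pi.neg_apply, neg_sub_neg, ← neg_sub, neg_div, neg_le] at hneg

theorem exists_adj_near_boundary (hε : ∀ h, ε h ∈ Ioo (0 : ℝ) 1)
    (hψ : ∀ i j, G.Adj i j → 0 < ψ i j t) (hx : IsTreeBounded G ψ ε t x)
    (h : FunnelTree G ψ ε U θ) (ha : a ∈ U) (hb : b ∈ U) (hab : a ≠ b)
    (heq : x a - x b = θ t) :
    (∃ c, G.Adj a c ∧ (x c - x a) / ψ a c t ≤ -(1 - ε U.card)) ∨
      ∃ c, G.Adj b c ∧ 1 - ε U.card ≤ (x c - x b) / ψ b c t := by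
  cases h with
  | single r =>
    exact absurd ((Finset.mem_singleton.1 ha).trans (Finset.mem_singleton.1 hb).symm) hab
  | @attach U θ d c h hc hd hdc =>
    have hpos := hψ _ _ hdc
    have hedge : 0 < (1 - ε (U.card + 1)) * ψ d c t := mul_pos (sub_pos.2 (hε _).2) hpos
    rw [Finset.card_insert_of_notMem hd]
    simp only at heq
    rcases Finset.mem_insert.1 ha with rfl | haU <;> rcases Finset.mem_insert.1 hb with rfl | hbU
    · exact absurd rfl hab
    · refine Or.inl ⟨c, hdc, ?_⟩
      rw [div_le_iff₀ hpos]
      linarith [hx U θ h c hc b hbU]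
    · refine Or.inr ⟨c, hdc, ?_⟩
      rw [le_div_iff₀ hpos]
      linarith [hx U θ h a haU c hc]
    · linarith [hx U θ h a haU b hbU]

end FunnelTree

end FunnelTree

/-! ### Uniform funnel margins -/

theorem sum_le_card_mul {ι : Type*} [Fintype ι] {s : Finset ι} {f : ι → ℝ} {K : ℝ} (hK : 0 ≤ K)
    (hf : ∀ i ∈ s, f i ≤ K) : ∑ i ∈ s, f i ≤ Fintype.card ι * K := by
  refine (Finset.sum_le_card_nsmul s f K hf).trans ?_
  rw [nsmul_eq_mul]
  gcongr
  exact Finset.card_le_univ s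

theorem sum_le_add_card_mul {ι : Type*} [Fintype ι] {s : Finset ι} {f : ι → ℝ} {c : ι} {R K : ℝ}
    (hc : c ∈ s) (hR : f c ≤ R) (hK : 0 ≤ K) (hf : ∀ i ∈ s, f i ≤ K) :
    ∑ i ∈ s, f i ≤ R + Fintype.card ι * K := by
  classical
  rw [← Finset.add_sum_erase s f hc]
  exact add_le_add hR (sum_le_card_mul hK fun i hi => hf i (Finset.mem_of_mem_erase hi))

-- A barrier that is not yet reached is respected for a short time by continuity, so only those
-- that are attained need `hstep`.
theorem forall_le_of_forall_eq_imp_eventually_le {ι : Type*} [Finite ι] {g θ : ι → ℝ → ℝ}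
    {a b : ℝ} (hg : ∀ i, ContinuousOn (g i) (Icc a b)) (hθ : ∀ i, ContinuousOn (θ i) (Icc a b))
    (ha : ∀ i, g i a ≤ θ i a)
    (hstep : ∀ t ∈ Ico a b, (∀ i, g i t ≤ θ i t) →
      ∀ i, g i t = θ i t → ∀ᶠ s in 𝓝[>] t, g i s ≤ θ i s) :
    ∀ t ∈ Icc a b, ∀ i, g i t ≤ θ i t := by
  have hclosed : IsClosed ({t | ∀ i, g i t ≤ θ i t} ∩ Icc a b) := by
    have hinter : {t | ∀ i, g i t ≤ θ i t} ∩ Icc a b =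
        Icc a b ∩ ⋂ i, {t ∈ Icc a b | g i t ≤ θ i t} := by
      ext t
      simp only [mem_inter_iff, mem_ofPred_eq, mem_iInter]
      exact ⟨fun h => ⟨h.2, fun i => ⟨h.2, h.1 i⟩⟩, fun h => ⟨fun i => (h.2 i).2, h.1⟩⟩
    rw [hinter]
    exact isClosed_Icc.inter (isClosed_iInter fun i => isClosed_Icc.isClosed_le (hg i) (hθ i))
  refine hclosed.Icc_subset_of_forall_exists_gt ha ?_
  rintro t ⟨htS, ht⟩ u hu
  have hnhds : 𝓝[>] t ≤ 𝓝[Icc a b] t := by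
    rw [← nhdsWithin_Ioo_eq_nhdsGT ht.2]
    exact nhdsWithin_mono _ fun s hs => ⟨ht.1.trans hs.1.le, hs.2.le⟩
  have hnear : ∀ᶠ s in 𝓝[>] t, ∀ i, g i s ≤ θ i s := by
    refine eventually_all.2 fun i => ?_
    rcases (htS i).lt_or_eq with hlt | heq
    · have htI := Ico_subset_Icc_self ht
      exact (((hg i t htI).tendsto.mono_left hnhds).eventually_lt
        ((hθ i t htI).tendsto.mono_left hnhds) hlt).mono fun s => le_of_lt
    · exact hstep t ht htS i heq
  exact (hnear.and (Ioc_mem_nhdsGT hu)).exists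

section ScalarNetwork

variable {V : Type*} {G : SimpleGraph V} {ψ μ : V → V → ℝ → ℝ} {t₀ : ℝ} {ω : EReal} {B : NNReal}

/-- Symmetric, positive and uniformly Lipschitz performance functions on the edges of `G`. -/
structure IsFunnel (G : SimpleGraph V) (ψ : V → V → ℝ → ℝ) (t₀ : ℝ) (B : NNReal) : Prop where
  pos : ∀ i j, G.Adj i j → ∀ t, t₀ ≤ t → 0 < ψ i j t
  symm : ∀ i j, G.Adj i j → ∀ t, t₀ ≤ t → ψ i j t = ψ j i t
  lipschitz : ∀ i j, G.Adj i j → LipschitzOnWith B (ψ i j) (Ici t₀)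

theorem IsFunnel.sub_le (hψ : IsFunnel G ψ t₀ B) {i j : V} (hij : G.Adj i j) {s t : ℝ}
    (hs : t₀ ≤ s) (hst : s ≤ t) : ψ i j s - ψ i j t ≤ B * (t - s) := by
  have hdist := (hψ.lipschitz i j hij).dist_le_mul s hs t (hs.trans hst)
  rw [Real.dist_eq, dist_comm, Real.dist_eq, abs_of_nonneg (sub_nonneg.2 hst)] at hdist
  exact (le_abs_self _).trans hdist

theorem IsFunnel.continuousOn (hψ : IsFunnel G ψ t₀ B) {s : Set ℝ} (hs : s ⊆ Ici t₀) {i j : V}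
    (hij : G.Adj i j) : ContinuousOn (ψ i j) s :=
  (hψ.lipschitz i j hij).continuousOn.mono hs

variable [Fintype V]

open Classical in
/-- The sum of the scalar couplings `μ i j ((x j - x i) / ψ i j)` over the neighbours of `i`. -/
noncomputable def couplingSum (G : SimpleGraph V) (ψ μ : V → V → ℝ → ℝ) (t : ℝ) (x : V → ℝ)
    (i : V) : ℝ :=
  ∑ j with G.Adj i j, μ i j ((x j - x i) / ψ i j t)

/-- `x` solves the scalar funnel coupled network with drifts `f` on `[t₀, ω)`, inside the
funnel. -/
structure IsScalarSolution (G : SimpleGraph V) (ψ μ : V → V → ℝ → ℝ) (t₀ : ℝ) (ω : EReal)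
    (f x : ℝ → V → ℝ) : Prop where
  deriv : ∀ i, HasCaratheodoryDeriv t₀ ω (fun t => x t i)
    (fun t => f t i + couplingSum G ψ μ t (x t) i)
  abs_lt : ∀ t, t₀ ≤ t → (t : EReal) < ω → ∀ i j, G.Adj i j → |x t j - x t i| < ψ i j t

theorem continuousOn_couplingSum (hμ : ∀ i j, G.Adj i j → ContinuousOn (μ i j) (Ioo (-1) 1))
    {X : Type*} [TopologicalSpace X] {s : Set X} {τ : X → ℝ} {x : X → V → ℝ}
    (hx : ∀ i, ContinuousOn (fun q => x q i) s)
    (hψ : ∀ i j, G.Adj i j → ContinuousOn (fun q => ψ i j (τ q)) s)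
    (hin : ∀ q ∈ s, ∀ i j, G.Adj i j → |x q j - x q i| < ψ i j (τ q)) (i : V) :
    ContinuousOn (fun q => couplingSum G ψ μ (τ q) (x q) i) s := by
  classical
  refine continuousOn_finsetSum _ fun j hj => ?_
  have hij : G.Adj i j := (Finset.mem_filter.1 hj).2
  exact (hμ i j hij).comp (((hx j).sub (hx i)).div (hψ i j hij)
    fun q hq => ((abs_nonneg _).trans_lt (hin q hq i j hij)).ne')
    fun q hq => div_mem_Ioo_of_abs_lt (hin q hq i j hij)

-- At `a` and `b` all couplings that increase `x a - x b` are at most `K`, and the edge from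
-- `exists_adj_near_boundary` contributes `-R`.
theorem FunnelTree.couplingSum_sub_le [DecidableEq V] {ε : ℕ → ℝ} {K R t : ℝ} {x : V → ℝ}
    (hε : ∀ h, ε h ∈ Ioo (0 : ℝ) 1) (hsymm : ∀ i j, G.Adj i j → ψ i j t = ψ j i t)
    (hin : ∀ i j, G.Adj i j → |x j - x i| < ψ i j t) (hx : IsTreeBounded G ψ ε t x)
    {U : Finset V} {θ : ℝ → ℝ} (h : FunnelTree G ψ ε U θ) {a b : V} (ha : a ∈ U) (hb : b ∈ U)
    (hab : a ≠ b) (heq : x a - x b = θ t) (hK₀ : 0 ≤ K)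
    (hK : ∀ i j, G.Adj i j → BoundedAwayFromPoles (μ i j) (ε (U.card + 1)) K)
    (hR : ∀ i j, G.Adj i j → LargeNearPoles (μ i j) (ε U.card) R) :
    couplingSum G ψ μ t x a - couplingSum G ψ μ t x b ≤ -R + 2 * Fintype.card V * K := by
  classical
  have hψ : ∀ i j, G.Adj i j → 0 < ψ i j t := fun i j hij =>
    (abs_nonneg _).trans_lt (hin i j hij)
  have hmem : ∀ i j, G.Adj i j → (x j - x i) / ψ i j t ∈ Ioo (-1 : ℝ) 1 := fun i j hij =>
    div_mem_Ioo_of_abs_lt (hin i j hij)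
  have hupper : ∀ j ∈ Finset.univ.filter (G.Adj a), μ a j ((x j - x a) / ψ a j t) ≤ K := by
    intro j hj
    have hadj := (Finset.mem_filter.1 hj).2
    exact (hK a j hadj _ (hmem a j hadj)).1 (h.div_le_of_sub_eq hε hψ hsymm hx ha hb heq hadj)
  have hlower : ∀ j ∈ Finset.univ.filter (G.Adj b), -μ b j ((x j - x b) / ψ b j t) ≤ K := by
    intro j hj
    have hadj := (Finset.mem_filter.1 hj).2
    exact neg_le.1 ((hK b j hadj _ (hmem b j hadj)).2
      (h.le_div_of_sub_eq hε hψ hsymm hx ha hb heq hadj))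
  rw [couplingSum, couplingSum, sub_eq_add_neg, ← Finset.sum_neg_distrib]
  rcases h.exists_adj_near_boundary hε hψ hx ha hb hab heq with ⟨c, hc, hnear⟩ | ⟨c, hc, hnear⟩
  · have hsum_a := sum_le_add_card_mul (c := c) (by simpa using hc)
      ((hR a c hc _ (hmem a c hc)).2 hnear) hK₀ hupper
    linarith [sum_le_card_mul hK₀ hlower]
  · have hsum_b := sum_le_add_card_mul (c := c) (by simpa using hc)
      (neg_le_neg ((hR b c hc _ (hmem b c hc)).1 hnear)) hK₀ hlower
    linarith [sum_le_card_mul hK₀ hupper]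

namespace IsScalarSolution

variable {f x : ℝ → V → ℝ} {C : ℝ}

theorem eventually_couplingSum_sub_le (hx : IsScalarSolution G ψ μ t₀ ω f x)
    (hψ : IsFunnel G ψ t₀ B) (hμ : ∀ i j, G.Adj i j → ContinuousOn (μ i j) (Ioo (-1) 1))
    {t T : ℝ} (ht : t ∈ Ico t₀ T) (hT : (T : EReal) < ω) {a b : V} {D : ℝ}
    (hlt : couplingSum G ψ μ t (x t) a - couplingSum G ψ μ t (x t) b < D) :
    ∀ᶠ s in 𝓝[>] t, couplingSum G ψ μ s (x s) a - couplingSum G ψ μ s (x s) b ≤ D := by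
  have hcont : ∀ i, ContinuousOn (fun s => couplingSum G ψ μ s (x s) i) (Icc t₀ T) :=
    continuousOn_couplingSum hμ (fun i => (hx.deriv i).continuousOn (ht.1.trans ht.2.le) hT)
      (fun i j => hψ.continuousOn Icc_subset_Ici_self)
      fun s hs => hx.abs_lt s hs.1 ((EReal.coe_le_coe hs.2).trans_lt hT)
  have hnhds : 𝓝[>] t ≤ 𝓝[Icc t₀ T] t := nhdsWithin_le_of_mem
    (mem_of_superset (Ioo_mem_nhdsGT ht.2) fun s hs => ⟨ht.1.trans hs.1.le, hs.2.le⟩)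
  exact ((((hcont a).sub (hcont b)) t (Ico_subset_Icc_self ht)).tendsto.mono_left
    hnhds).eventually_le_const hlt

-- When `x a - x b` reaches the barrier `θ`, its derivative is below `-|V| B`, which bounds the
-- slope of `θ` from below.
theorem eventually_sub_le_of_sub_eq [DecidableEq V] (hx : IsScalarSolution G ψ μ t₀ ω f x)
    (hψ : IsFunnel G ψ t₀ B) (hμ : ∀ i j, G.Adj i j → ContinuousOn (μ i j) (Ioo (-1) 1))
    (hf : ∀ t, t₀ ≤ t → (t : EReal) < ω → ∀ i j, f t i - f t j ≤ C)
    {ε : ℕ → ℝ} (hε : ∀ h, ε h ∈ Ioo (0 : ℝ) 1) {K t T : ℝ} (ht : t ∈ Ico t₀ T)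
    (hT : (T : EReal) < ω) (htree : IsTreeBounded G ψ ε t (x t))
    {U : Finset V} {θ : ℝ → ℝ} (hU : FunnelTree G ψ ε U θ) {a b : V} (ha : a ∈ U) (hb : b ∈ U)
    (heq : x t a - x t b = θ t) (hK₀ : 0 ≤ K)
    (hK : ∀ i j, G.Adj i j → BoundedAwayFromPoles (μ i j) (ε (U.card + 1)) K)
    (hR : ∀ i j, G.Adj i j → LargeNearPoles (μ i j) (ε U.card)
      (C + Fintype.card V * B + 1 + 2 * Fintype.card V * K)) :
    ∀ᶠ s in 𝓝[>] t, x s a - x s b ≤ θ s := by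
  rcases eq_or_ne a b with rfl | hab
  · filter_upwards [self_mem_nhdsWithin] with s hs
    rw [sub_self]
    exact hU.nonneg hε fun i j hij => hψ.pos i j hij s (ht.1.trans (le_of_lt hs))
  have hlt : ∀ s ≤ T, (s : EReal) < ω := fun s hs => (EReal.coe_le_coe hs).trans_lt hT
  have hcouple : couplingSum G ψ μ t (x t) a - couplingSum G ψ μ t (x t) b <
      -(C + Fintype.card V * B) := by
    have := hU.couplingSum_sub_le hε (fun i j hij => hψ.symm i j hij t ht.1)
      (hx.abs_lt t ht.1 (hlt t ht.2.le)) htree ha hb hab heq hK₀ hK hR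
    linarith
  have hdescent : ∀ᶠ s in 𝓝[>] t,
      (x s a - x s b) - (x t a - x t b) ≤ -(Fintype.card V * B) * (s - t) := by
    refine ((hx.deriv a).sub (hx.deriv b)).eventually_sub_le_mul ht.1 (hlt t ht.2.le) ?_
    filter_upwards [hx.eventually_couplingSum_sub_le hψ hμ ht hT hcouple, Ioo_mem_nhdsGT ht.2]
      with s hs hsT
    linarith [hf s (ht.1.trans hsT.1.le) (hlt s hsT.2.le) a b]
  filter_upwards [hdescent, self_mem_nhdsWithin] with s hs hts
  have hts : t ≤ s := le_of_lt hts
  have hθ := hU.sub_le hε hts B.coe_nonneg fun i j hij => hψ.sub_le hij ht.1 hts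
  have hcard : (U.card : ℝ) * (B * (s - t)) ≤ Fintype.card V * (B * (s - t)) :=
    mul_le_mul_of_nonneg_right (Nat.cast_le.2 (Finset.card_le_univ U))
      (mul_nonneg B.coe_nonneg (sub_nonneg.2 hts))
  linarith

theorem isTreeBounded [DecidableEq V] (hx : IsScalarSolution G ψ μ t₀ ω f x)
    (hψ : IsFunnel G ψ t₀ B) (hμ : ∀ i j, G.Adj i j → ContinuousOn (μ i j) (Ioo (-1) 1))
    (hf : ∀ t, t₀ ≤ t → (t : EReal) < ω → ∀ i j, f t i - f t j ≤ C)
    {ε : ℕ → ℝ} (hε : ∀ h, ε h ∈ Ioo (0 : ℝ) 1)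
    (hscale : ∀ h ≤ Fintype.card V, ∃ K, 0 ≤ K ∧
      (∀ i j, G.Adj i j → BoundedAwayFromPoles (μ i j) (ε (h + 1)) K) ∧
      ∀ i j, G.Adj i j → LargeNearPoles (μ i j) (ε h)
        (C + Fintype.card V * B + 1 + 2 * Fintype.card V * K))
    (hinit : IsTreeBounded G ψ ε t₀ (x t₀)) {T : ℝ} (hT : t₀ ≤ T) (hTω : (T : EReal) < ω) :
    IsTreeBounded G ψ ε T (x T) := by
  let ι := {q : (Finset V × (ℝ → ℝ)) × V × V //
    FunnelTree G ψ ε q.1.1 q.1.2 ∧ q.2.1 ∈ q.1.1 ∧ q.2.2 ∈ q.1.1}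
  have : Finite ι := ((FunnelTree.finite.prod (Set.finite_univ (α := V × V))).subset
    fun q hq => ⟨hq.1, mem_univ _⟩).to_subtype
  have hcont : ∀ i, ContinuousOn (fun t => x t i) (Icc t₀ T) := fun i =>
    (hx.deriv i).continuousOn hT hTω
  have hbarrier := forall_le_of_forall_eq_imp_eventually_le (ι := ι)
    (g := fun q t => x t q.1.2.1 - x t q.1.2.2) (θ := fun q => q.1.1.2)
    (fun q => (hcont _).sub (hcont _))
    (fun q => q.2.1.continuousOn fun i j => hψ.continuousOn Icc_subset_Ici_self)
    (fun q => hinit _ _ q.2.1 _ q.2.2.1 _ q.2.2.2)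
    fun t ht hle q heq => by
      obtain ⟨K, hK₀, hK, hR⟩ := hscale q.1.1.1.card (Finset.card_le_univ _)
      exact hx.eventually_sub_le_of_sub_eq hψ hμ hf hε ht hTω
        (fun U θ hU a ha b hb => hle ⟨((U, θ), a, b), hU, ha, hb⟩) q.2.1 q.2.2.1 q.2.2.2 heq
        hK₀ hK hR
  exact fun U θ hU a ha b hb => hbarrier T ⟨hT, le_rfl⟩ ⟨((U, θ), a, b), hU, ha, hb⟩

theorem exists_margin (hx : IsScalarSolution G ψ μ t₀ ω f x) (hω : (t₀ : EReal) < ω)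
    (hψ : IsFunnel G ψ t₀ B) (hμ : ∀ i j, G.Adj i j → IsPolarCoupling (μ i j))
    (hf : ∀ t, t₀ ≤ t → (t : EReal) < ω → ∀ i j, f t i - f t j ≤ C) :
    ∃ ε ∈ Ioo (0 : ℝ) 1, ∀ t, t₀ ≤ t → (t : EReal) < ω → ∀ i j, G.Adj i j →
      |x t j - x t i| ≤ (1 - ε) * ψ i j t := by
  classical
  obtain ⟨ε₀, hε₀, hinit⟩ := exists_forall_le_one_sub_mul fun q : {q : V × V // G.Adj q.1 q.2} =>
    hx.abs_lt t₀ le_rfl hω _ _ q.2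
  obtain ⟨ε, hε, hscale⟩ := exists_threshold_scale (ι := {q : V × V // G.Adj q.1 q.2})
    (fun q => hμ _ _ q.2) (C + Fintype.card V * B + 1) (2 * Fintype.card V) (Fintype.card V) hε₀.1
  have hε' : ∀ h, ε h ∈ Ioo (0 : ℝ) 1 := fun h => ⟨(hε h).1, (hε h).2.trans_lt hε₀.2⟩
  have htree : ∀ t, t₀ ≤ t → (t : EReal) < ω → IsTreeBounded G ψ ε t (x t) := fun t =>
    hx.isTreeBounded hψ (fun i j hij => (hμ i j hij).continuousOn) hf hε'
      (fun h hh => (hscale h hh).imp fun K hK => ⟨hK.1, fun i j hij => hK.2.1 ⟨(i, j), hij⟩,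
        fun i j hij => hK.2.2 ⟨(i, j), hij⟩⟩)
      (isTreeBounded_of_margin hε hε₀.2 (fun i j hij => hψ.pos i j hij t₀ le_rfl)
        fun i j hij => hinit ⟨(i, j), hij⟩)
  have hedge : ∀ t, t₀ ≤ t → (t : EReal) < ω → ∀ i j, G.Adj i j →
      x t j - x t i ≤ (1 - ε 2) * ψ i j t := by
    intro t ht htω i j hij
    have := htree t ht htω _ _ ((FunnelTree.single j).attach (Finset.mem_singleton_self j)
      (by simpa using hij.ne) hij) j (by simp) i (Finset.mem_insert_self _ _)
    simpa using this
  refine ⟨ε 2, hε' 2, fun t ht htω i j hij => abs_le.2 ⟨?_, hedge t ht htω i j hij⟩⟩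
  rw [hψ.symm i j hij t ht, neg_le, neg_sub]
  exact hedge t ht htω j i hij.symm

end IsScalarSolution

end ScalarNetwork

/-! ### Carathéodory fields and funnel couplings -/

namespace IsCaratheodoryField

variable {X E : Type*} [NormedAddCommGroup X] [NormedAddCommGroup E] {t₀ : ℝ} {f : ℝ → X → E}

theorem continuous (hf : IsCaratheodoryField t₀ f) {t : ℝ} (ht : t₀ ≤ t) : Continuous (f t) := by
  refine continuous_iff_continuousAt.2 fun x₀ => ?_
  obtain ⟨U, hU, L, -, hL⟩ := hf.locallyLipschitz x₀
  refine tendsto_iff_norm_sub_tendsto_zero.2 (squeeze_zero' (g := fun x => L t * ‖x - x₀‖)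
    (Eventually.of_forall fun x => norm_nonneg _) ?_ ?_)
  · exact mem_of_superset hU fun x hx => hL t ht x hx x₀ (mem_of_mem_nhds hU)
  · exact Continuous.tendsto' (by fun_prop) _ _ (by simp)

theorem exists_forall_norm_le [ProperSpace X] (hf : IsCaratheodoryField t₀ f) (R : ℝ) :
    ∃ M, ∀ t, t₀ ≤ t → ∀ x, ‖x‖ ≤ R → ‖f t x‖ ≤ M := by
  obtain ⟨M, hM⟩ := hf.bounded _ (isCompact_closedBall (0 : X) R)
  exact ⟨M, fun t ht x hx => hM t ht x (mem_closedBall_zero_iff.2 hx)⟩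

theorem exists_eventually_norm_sub_le (hf : IsCaratheodoryField t₀ f) {t : ℝ} (ht : t₀ ≤ t)
    (T : ℝ) {ξ ξ' : ℝ → X} (hξ : ContinuousWithinAt ξ (Ioi t) t)
    (hξ' : ContinuousWithinAt ξ' (Ioi t) t) (heq : ξ t = ξ' t) :
    ∃ L : ℝ → ℝ, (∀ r, 0 ≤ L r) ∧ IntegrableOn L (Icc t T) ∧
      ∀ᶠ r in 𝓝[>] t, ‖f r (ξ r) - f r (ξ' r)‖ ≤ L r * ‖ξ r - ξ' r‖ := by
  obtain ⟨U, hU, L, hL, hLip⟩ := hf.locallyLipschitz (ξ t)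
  refine ⟨fun r => |L r|, fun r => abs_nonneg _,
    (hL.integrableOn_compact_subset (Icc_subset_Ici_self.trans (Ici_subset_Ici.2 ht))
      isCompact_Icc).abs, ?_⟩
  filter_upwards [hξ hU, hξ' (heq ▸ hU), self_mem_nhdsWithin] with r hr hr' htr
  exact (hLip r (ht.trans (le_of_lt htr)) _ hr _ hr').trans
    (mul_le_mul_of_nonneg_right (le_abs_self _) (norm_nonneg _))

end IsCaratheodoryField

theorem abs_div_le_of_abs_le_mul {a b q : ℝ} (hb : 0 < b) (h : |a| ≤ q * b) : |a / b| ≤ q := by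
  rwa [abs_div, abs_of_pos hb, div_le_iff₀ hb]

namespace FunnelCoupling

variable {N m : ℕ} {c : FunnelCoupling N m} {t₀ : ℝ}

/-- Index type of the scalar couplings: an oriented edge together with a component. -/
abbrev EdgeComponent (c : FunnelCoupling N m) : Type :=
  {q : Fin N × Fin N × Fin m // c.graph.Adj q.1 q.2.1}

/-- `y` lies in the funnel shrunk by the factor `1 - ε`. -/
def HasMargin (c : FunnelCoupling N m) (ε t : ℝ) (y : Fin N → Fin m → ℝ) : Prop :=
  ∀ i j, c.graph.Adj i j → ∀ p, |y j p - y i p| ≤ (1 - ε) * c.ψ i j p t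

theorem edgeSum_apply (i : Fin N) (t : ℝ) (y : Fin N → Fin m → ℝ) (p : Fin m) :
    c.edgeSum i t y p = couplingSum c.graph (fun i j => c.ψ i j p) (fun i j => c.μ i j p) t
      (fun j => y j p) i := by
  rw [edgeSum, Finset.sum_apply, couplingSum]

namespace IsAdmissible

theorem isPolarCoupling (hc : c.IsAdmissible t₀) {i j : Fin N} (hij : c.graph.Adj i j)
    (p : Fin m) : IsPolarCoupling (c.μ i j p) :=
  ⟨hc.μ_cont i j hij p, hc.μ_right i j hij p, hc.μ_left i j hij p⟩

theorem exists_isFunnel (hc : c.IsAdmissible t₀) :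
    ∃ B : NNReal, ∀ p, IsFunnel c.graph (fun i j => c.ψ i j p) t₀ B := by
  choose b hb using fun q : c.EdgeComponent => hc.ψ_deriv_bounded _ _ q.2 q.1.2.2
  obtain ⟨B, hB⟩ := Finite.exists_le b
  refine ⟨B.toNNReal, fun p => ⟨fun i j hij => hc.ψ_pos i j hij p,
    fun i j hij => hc.ψ_symm i j hij p, fun i j hij => ?_⟩⟩
  refine Convex.lipschitzOnWith_of_nnnorm_derivWithin_le (𝕜 := ℝ) (convex_Ici t₀)
    ((hc.ψ_contDiff i j hij p).differentiableOn one_ne_zero) fun t ht => ?_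
  exact NNReal.le_toNNReal_of_coe_le ((hb ⟨(i, j, p), hij⟩ t ht).trans (hB _))

theorem continuousOn (hc : c.IsAdmissible t₀) {i j : Fin N} (hij : c.graph.Adj i j) (p : Fin m) :
    ContinuousOn (c.ψ i j p) (Ici t₀) :=
  (hc.ψ_contDiff i j hij p).continuousOn

theorem exists_coupling_bound (hc : c.IsAdmissible t₀) {ε : ℝ} (hε : 0 < ε) :
    ∃ K, 0 ≤ K ∧ ∀ i j, c.graph.Adj i j → ∀ p s, |s| ≤ 1 - ε → |c.μ i j p s| ≤ K := by
  choose A hA using fun q : c.EdgeComponent =>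
    (isCompact_Icc (a := -(1 - ε)) (b := 1 - ε)).exists_bound_of_continuousOn
      ((hc.μ_cont _ _ q.2 q.1.2.2).mono fun s hs => ⟨by linarith [hs.1], by linarith [hs.2]⟩)
  obtain ⟨K, hK⟩ := Finite.exists_le A
  exact ⟨max K 0, le_max_right _ _, fun i j hij p s hs => ((hA ⟨(i, j, p), hij⟩ s
    (abs_le.1 hs)).trans (hK _)).trans (le_max_left _ _)⟩

theorem exists_edgeSum_bound (hc : c.IsAdmissible t₀) {ε : ℝ} (hε : 0 < ε) :
    ∃ K, 0 ≤ K ∧ ∀ t, t₀ ≤ t → ∀ y, c.HasMargin ε t y → ∀ i, ‖c.edgeSum i t y‖ ≤ K := by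
  classical
  obtain ⟨K, hK₀, hK⟩ := hc.exists_coupling_bound hε
  have hNK : 0 ≤ N * K := by positivity
  refine ⟨N * K, hNK, fun t ht y hy i => (pi_norm_le_iff_of_nonneg hNK).2 fun p => ?_⟩
  rw [edgeSum_apply, couplingSum, Real.norm_eq_abs]
  calc |∑ j with c.graph.Adj i j, c.μ i j p ((y j p - y i p) / c.ψ i j p t)|
      ≤ ∑ j with c.graph.Adj i j, |c.μ i j p ((y j p - y i p) / c.ψ i j p t)| :=
        Finset.abs_sum_le_sum_abs _ _
    _ ≤ Fintype.card (Fin N) * K := sum_le_card_mul hK₀ fun j hj => by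
        have hij := (Finset.mem_filter.1 hj).2
        exact hK i j hij p _ (abs_div_le_of_abs_le_mul (hc.ψ_pos i j hij p t ht) (hy i j hij p))
    _ = N * K := by rw [Fintype.card_fin]

theorem continuousOn_edgeSum (hc : c.IsAdmissible t₀) {X : Type*} [TopologicalSpace X] {s : Set X}
    {τ : X → ℝ} {y : X → Fin N → Fin m → ℝ} (hτ : ContinuousOn τ s) (hτ₀ : MapsTo τ s (Ici t₀))
    (hy : ContinuousOn y s) (hin : ∀ q ∈ s, c.InFunnel (τ q) (y q)) (i : Fin N) :
    ContinuousOn (fun q => c.edgeSum i (τ q) (y q)) s := by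
  refine continuousOn_pi.2 fun p => ?_
  simp only [edgeSum_apply]
  exact continuousOn_couplingSum (fun i j hij => hc.μ_cont i j hij p)
    (fun j => continuousOn_pi.1 (continuousOn_pi.1 hy j) p)
    (fun i j hij => (hc.continuousOn hij p).comp hτ hτ₀)
    (fun q hq i j hij => hin q hq i j hij p) i

end IsAdmissible

theorem HasMargin.inFunnel (hc : c.IsAdmissible t₀) {ε t : ℝ} (hε : 0 < ε) (ht : t₀ ≤ t)
    {y : Fin N → Fin m → ℝ} (hy : c.HasMargin ε t y) : c.InFunnel t y := fun i j hij p =>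
  (hy i j hij p).trans_lt (mul_lt_of_lt_one_left (hc.ψ_pos i j hij p t ht) (sub_lt_self 1 hε))

theorem HasMargin.of_tendsto (hc : c.IsAdmissible t₀) {ε t : ℝ} (ht : t₀ ≤ t)
    {l : Filter ℝ} [l.NeBot] (hl : l ≤ 𝓝[Ici t₀] t) {y : ℝ → Fin N → Fin m → ℝ}
    {y₁ : Fin N → Fin m → ℝ} (hy : Tendsto y l (𝓝 y₁))
    (hmargin : ∀ᶠ r in l, c.HasMargin ε r (y r)) : c.HasMargin ε t y₁ := by
  intro i j hij p
  have hcomp : ∀ i, Tendsto (fun r => y r i p) l (𝓝 (y₁ i p)) := fun i =>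
    tendsto_pi_nhds.1 (tendsto_pi_nhds.1 hy i) p
  exact le_of_tendsto_of_tendsto ((hcomp j).sub (hcomp i)).abs
    (((hc.continuousOn hij p t ht).tendsto.mono_left hl).const_mul _)
    (hmargin.mono fun r hr => hr i j hij p)

theorem InFunnel.eventually_hasMargin (hc : c.IsAdmissible t₀) {a : ℝ} (ha : t₀ ≤ a)
    {y₀ : Fin N → Fin m → ℝ} (hy₀ : c.InFunnel a y₀) :
    ∃ ε > 0, ∀ᶠ q in 𝓝[≥] a ×ˢ 𝓝 y₀, c.HasMargin ε q.1 q.2 := by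
  obtain ⟨ε, hε, hmargin⟩ :=
    exists_forall_le_one_sub_mul fun q : c.EdgeComponent => hy₀ _ _ q.2 q.1.2.2
  have hnear : ∀ q : c.EdgeComponent, ∀ᶠ x in 𝓝[≥] a ×ˢ 𝓝 y₀,
      |x.2 q.1.2.1 q.1.2.2 - x.2 q.1.1 q.1.2.2| <
        (1 - ε / 2) * c.ψ q.1.1 q.1.2.1 q.1.2.2 x.1 := by
    rintro ⟨⟨i, j, p⟩, hij⟩
    have hψ : Tendsto (fun x : ℝ × (Fin N → Fin m → ℝ) => (1 - ε / 2) * c.ψ i j p x.1)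
        (𝓝[≥] a ×ˢ 𝓝 y₀) (𝓝 ((1 - ε / 2) * c.ψ i j p a)) :=
      ((((hc.continuousOn hij p).mono (Ici_subset_Ici.2 ha)) a self_mem_Ici).tendsto.comp
        tendsto_fst).const_mul _
    have hy : Tendsto (fun x : ℝ × (Fin N → Fin m → ℝ) => |x.2 j p - x.2 i p|)
        (𝓝[≥] a ×ˢ 𝓝 y₀) (𝓝 |y₀ j p - y₀ i p|) :=
      (Continuous.tendsto (by fun_prop : Continuous fun y : Fin N → Fin m → ℝ =>
        |y j p - y i p|) y₀).comp tendsto_snd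
    refine hy.eventually_lt hψ ((hmargin ⟨(i, j, p), hij⟩).trans_lt ?_)
    exact mul_lt_mul_of_pos_right (by linarith [hε.1]) (hc.ψ_pos i j hij p a ha)
  exact ⟨ε / 2, half_pos hε.1, (eventually_all.2 hnear).mono fun x hx i j hij p =>
    (hx ⟨(i, j, p), hij⟩).le⟩

end FunnelCoupling

/-! ### Maximal Carathéodory trajectories -/

section Trajectories

variable {E : Type*} [NormedAddCommGroup E] [NormedSpace ℝ E]

/-- `x` solves `x' = g(t, x)` on `[t₀, ω)` in the sense of Carathéodory, with `x(t) ∈ D(t)`. -/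
structure IsTrajectory (D : ℝ → Set E) (g : ℝ → E → E) (t₀ : ℝ) (ω : EReal) (x : ℝ → E) :
    Prop where
  lt : (t₀ : EReal) < ω
  mem : ∀ t, t₀ ≤ t → (t : EReal) < ω → x t ∈ D t
  deriv : HasCaratheodoryDeriv t₀ ω x fun t => g t (x t)

/-- A trajectory on `[t₀, ω)` that has no proper extension. -/
def IsMaximalTrajectory (D : ℝ → Set E) (g : ℝ → E → E) (t₀ : ℝ) (ω : EReal) (x : ℝ → E) : Prop :=
  IsTrajectory D g t₀ ω x ∧ ∀ ω' x', IsTrajectory D g t₀ ω' x' → ω ≤ ω' →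
    (∀ t, t₀ ≤ t → (t : EReal) < ω → x' t = x t) → ω' = ω

/-- From every time after `t₀` and every admissible state, `x' = g(t, x)` has a Lipschitz solution
on a short time interval. -/
def IsLocallySolvable (D : ℝ → Set E) (g : ℝ → E → E) (t₀ : ℝ) : Prop :=
  ∀ a, t₀ ≤ a → ∀ x₀ ∈ D a, ∃ b > a, ∃ (x : ℝ → E) (K : NNReal), x a = x₀ ∧ LipschitzWith K x ∧
    (∀ t ∈ Icc a b, x t ∈ D t) ∧ ∀ᵐ t, t ∈ Ioo a b → HasDerivAt x (g t (x t)) t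

variable {D : ℝ → Set E} {g : ℝ → E → E} {t₀ : ℝ}

theorem IsLocallySolvable.exists_continuation (hg : IsLocallySolvable D g t₀) {a : ℝ}
    (ha : t₀ ≤ a) {x : ℝ → E} {K : NNReal} (hx : LipschitzWith K x)
    (hmem : ∀ t ∈ Icc t₀ a, x t ∈ D t)
    (hderiv : ∀ᵐ t, t₀ < t → t < a → HasDerivAt x (g t (x t)) t) :
    ∃ b > a, ∃ x', IsTrajectory D g t₀ (b : ℝ) x' ∧ ∀ t ∈ Icc t₀ a, x' t = x t := by
  obtain ⟨b, hab, x₂, K₂, hx₂a, hx₂, hmem₂, hderiv₂⟩ := hg a ha (x a) (hmem a ⟨ha, le_rfl⟩)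
  have hglue := HasCaratheodoryDeriv.ite_lt_of_lipschitz (K := max K K₂)
    (hx.weaken (le_max_left _ _)).lipschitzOnWith (hx₂.weaken (le_max_right _ _)).lipschitzOnWith
    hx₂a.symm hderiv hderiv₂
  refine ⟨b, hab, fun t => if t < a then x t else x₂ t, ⟨EReal.coe_lt_coe (ha.trans_lt hab),
    fun t ht htb => ?_, hglue.congr_deriv fun t _ _ => ?_⟩, fun t ht => ?_⟩
  · split_ifs with hta
    · exact hmem t ⟨ht, hta.le⟩
    · exact hmem₂ t ⟨not_lt.1 hta, (EReal.coe_lt_coe_iff.1 htb).le⟩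
  · split_ifs <;> rfl
  · rcases ht.2.lt_or_eq with hta | rfl
    · exact if_pos hta
    · exact (if_neg (lt_irrefl _)).trans hx₂a

/-- Trajectories with initial value `x₀`, together with the right end of their interval. -/
abbrev TrajectoryFrom (D : ℝ → Set E) (g : ℝ → E → E) (t₀ : ℝ) (x₀ : E) :=
  {q : EReal × (ℝ → E) // IsTrajectory D g t₀ q.1 q.2 ∧ q.2 t₀ = x₀}

namespace TrajectoryFrom

variable {x₀ : E}

/-- The order of the Zorn argument: `q` extends `p`. -/
def Extends (p q : TrajectoryFrom D g t₀ x₀) : Prop :=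
  p.1.1 ≤ q.1.1 ∧ ∀ t, t₀ ≤ t → (t : EReal) < p.1.1 → q.1.2 t = p.1.2 t

theorem Extends.trans {p q r : TrajectoryFrom D g t₀ x₀} (hpq : Extends p q)
    (hqr : Extends q r) : Extends p r :=
  ⟨hpq.1.trans hqr.1, fun t ht htp => (hqr.2 t ht (htp.trans_le hpq.1)).trans (hpq.2 t ht htp)⟩

theorem exists_extends_of_isChain {C : Set (TrajectoryFrom D g t₀ x₀)} (hC : IsChain Extends C)
    (hne : C.Nonempty) : ∃ u : TrajectoryFrom D g t₀ x₀, ∀ p ∈ C, Extends p u := by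
  let ω : EReal := sSup ((fun p : TrajectoryFrom D g t₀ x₀ => p.1.1) '' C)
  have hle : ∀ p ∈ C, p.1.1 ≤ ω := fun p hp => le_sSup (mem_image_of_mem _ hp)
  have hexists : ∀ t : ℝ, ∃ p ∈ C, (t : EReal) < ω → (t : EReal) < p.1.1 := by
    intro t
    by_cases ht : (t : EReal) < ω
    · obtain ⟨_, ⟨p, hp, rfl⟩, htp⟩ := lt_sSup_iff.1 ht
      exact ⟨p, hp, fun _ => htp⟩
    · exact ⟨hne.some, hne.some_mem, fun h => absurd h ht⟩
  choose P hPC hP using hexists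
  have hagree : ∀ p ∈ C, ∀ t : ℝ, t₀ ≤ t → (t : EReal) < p.1.1 → p.1.2 t = (P t).1.2 t := by
    intro p hp t ht htp
    rcases eq_or_ne p (P t) with heq | hneq
    · rw [← heq]
    · rcases hC hp (hPC t) hneq with h | h
      · exact (h.2 t ht htp).symm
      · exact h.2 t ht (hP t (htp.trans_le (hle p hp)))
  obtain ⟨u, -, hu, huC⟩ :=
    exists_seq_tendsto_sSup (hne.image fun p => p.1.1) (OrderTop.bddAbove _)
  choose A hAC hA using huC
  have hderiv : HasCaratheodoryDeriv t₀ ω (fun t => (P t).1.2 t) fun t => g t ((P t).1.2 t) := by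
    refine HasCaratheodoryDeriv.of_seq (u := u) (fun j => ?_)
      fun t ht => (hu.eventually (lt_mem_nhds ht)).exists
    rw [← hA j]
    exact (A j).2.1.deriv.congr (hagree _ (hAC j)) fun t ht htω => by
      rw [hagree _ (hAC j) t ht.le htω]
  exact ⟨⟨(ω, fun t => (P t).1.2 t), ⟨hne.some.2.1.lt.trans_le (hle _ hne.some_mem),
    fun t ht htω => (P t).2.1.mem t ht (hP t htω), hderiv⟩, (P t₀).2.2⟩,
    fun p hp => ⟨hle p hp, fun t ht htp => (hagree p hp t ht htp).symm⟩⟩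

end TrajectoryFrom

theorem IsLocallySolvable.exists_isMaximalTrajectory (hg : IsLocallySolvable D g t₀) {x₀ : E}
    (hx₀ : x₀ ∈ D t₀) : ∃ ω x, IsMaximalTrajectory D g t₀ ω x ∧ x t₀ = x₀ := by
  obtain ⟨b, -, x, hx, hxt₀⟩ := hg.exists_continuation le_rfl (LipschitzWith.const x₀)
    (fun t ht => by rwa [le_antisymm ht.2 ht.1])
    (Eventually.of_forall fun t ht htt₀ => absurd ht htt₀.not_gt)
  have : Nonempty (TrajectoryFrom D g t₀ x₀) := ⟨⟨(b, x), hx, hxt₀ t₀ ⟨le_rfl, le_rfl⟩⟩⟩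
  obtain ⟨q, hq⟩ := exists_maximal_of_nonempty_chains_bounded
    (fun C hC hne => TrajectoryFrom.exists_extends_of_isChain (D := D) (g := g) (t₀ := t₀)
      (x₀ := x₀) hC hne) TrajectoryFrom.Extends.trans
  refine ⟨q.1.1, q.1.2, ⟨q.2.1, fun ω' x' hx' hle hext => le_antisymm ?_ hle⟩, q.2.2⟩
  exact (hq ⟨(ω', x'), hx', (hext t₀ le_rfl q.2.1.lt).trans q.2.2⟩ ⟨hle, hext⟩).1

theorem IsMaximalTrajectory.eq_top_of_lipschitz [FiniteDimensional ℝ E] {ω : EReal} {x : ℝ → E}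
    {K : NNReal} (hg : IsLocallySolvable D g t₀) (hx : IsMaximalTrajectory D g t₀ ω x)
    (hlip : LipschitzOnWith K x {t | t₀ ≤ t ∧ (t : EReal) < ω})
    (hlim : ∀ (T : ℝ) (x₁ : E), (T : EReal) = ω → t₀ < T → Tendsto x (𝓝[<] T) (𝓝 x₁) →
      x₁ ∈ D T) : ω = ⊤ := by
  by_contra hω
  have hlt := hx.1.lt
  lift ω to ℝ using ⟨hω, (bot_le.trans_lt hlt).ne'⟩
  have hlt' : t₀ < ω := EReal.coe_lt_coe_iff.1 hlt
  simp only [EReal.coe_lt_coe_iff] at hlip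
  obtain ⟨x', hx', heq⟩ := hlip.extend_finite_dimension
  have hmem : ∀ t ∈ Icc t₀ ω, x' t ∈ D t := by
    intro t ht
    rcases ht.2.lt_or_eq with htω | rfl
    · rw [← heq ⟨ht.1, htω⟩]
      exact hx.1.mem t ht.1 (EReal.coe_lt_coe htω)
    · refine hlim t _ rfl hlt'
        (((hx'.continuous.tendsto t).mono_left nhdsWithin_le_nhds).congr' ?_)
      filter_upwards [Ioo_mem_nhdsLT hlt'] with s hs
      exact (heq ⟨hs.1.le, hs.2⟩).symm
  have hderiv : ∀ᵐ t, t₀ < t → t < ω → HasDerivAt x' (g t (x' t)) t := by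
    filter_upwards [hx.1.deriv.2] with t ht ht₀ htω
    rw [← heq ⟨ht₀.le, htω⟩]
    refine (ht ht₀ (EReal.coe_lt_coe htω)).congr_of_eventuallyEq ?_
    filter_upwards [Ioo_mem_nhds ht₀ htω] with s hs
    exact (heq ⟨hs.1.le, hs.2⟩).symm
  obtain ⟨b, hb, x₂, hx₂, hext⟩ := hg.exists_continuation hlt'.le hx' hmem hderiv
  have hbω := hx.2 b x₂ hx₂ (EReal.coe_lt_coe hb).le fun t ht htω => by
    have htω' := EReal.coe_lt_coe_iff.1 htω
    rw [hext t ⟨ht, htω'.le⟩, heq ⟨ht, htω'⟩]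
  exact hb.ne' (EReal.coe_injective hbω)

end Trajectories

/-! ### The closed loop -/

namespace AgentNetwork

variable {N m : ℕ} {n k : Fin N → ℕ} {S : AgentNetwork N m n k} {c : FunnelCoupling N m}
  {ω : EReal} {y : ℝ → Fin N → Fin m → ℝ} {z : ℝ → (i : Fin N) → Fin (n i) → ℝ}

theorem mulVec_input (hgain : S.HasBoundedInverseGain) {t : ℝ} (ht : S.t₀ ≤ t) (i : Fin N)
    (y : Fin N → Fin m → ℝ) (z : (i : Fin N) → Fin (n i) → ℝ) :
    (S.Γ i t (S.W i (y i) (z i))).mulVec (S.input c i t y z) = c.edgeSum i t y := by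
  rw [input, Matrix.mulVec_mulVec, Matrix.mul_nonsing_inv, Matrix.one_mulVec]
  exact (Matrix.isUnit_iff_isUnit_det _).1 (hgain.1 i t _ ht)

theorem norm_input_le {M K t : ℝ} {i : Fin N} {y : Fin N → Fin m → ℝ}
    {z : (i : Fin N) → Fin (n i) → ℝ} (hΓ : ‖(S.Γ i t (S.W i (y i) (z i)))⁻¹‖ ≤ M)
    (hK : ‖c.edgeSum i t y‖ ≤ K) : ‖S.input c i t y z‖ ≤ M * K :=
  (Matrix.linfty_opNorm_mulVec _ _).trans
    (mul_le_mul hΓ hK (norm_nonneg _) ((norm_nonneg _).trans hΓ))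

theorem IsSolution.y_deriv_edgeSum (h : S.IsSolution c ω y z) (hgain : S.HasBoundedInverseGain)
    (i : Fin N) : HasCaratheodoryDeriv S.t₀ ω (fun t => y t i)
      (fun t => S.F i t (y t i) (z t i) + c.edgeSum i t (y t)) :=
  (h.y_deriv i).congr_deriv fun t ht _ => by rw [mulVec_input hgain ht.le]

/-- Joint states `(y, z)` of all agents. -/
abbrev State (N m : ℕ) (n : Fin N → ℕ) : Type :=
  (Fin N → Fin m → ℝ) × ((i : Fin N) → Fin (n i) → ℝ)

/-- The right-hand side of the closed loop on the joint state space; the gains have been cancelled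
against the inverse gains of the coupling law. -/
noncomputable def closedLoop (S : AgentNetwork N m n k) (c : FunnelCoupling N m) (t : ℝ)
    (x : State N m n) : State N m n :=
  (fun i => S.F i t (x.1 i) (x.2 i) + c.edgeSum i t x.1, fun i => S.Z i t (x.2 i) (x.1 i))

/-- The joint states whose outputs lie inside the funnel. -/
def funnelDomain (n : Fin N → ℕ) (c : FunnelCoupling N m) (t : ℝ) : Set (State N m n) :=
  {x | c.InFunnel t x.1}

theorem isSolution_iff_isTrajectory (hgain : S.HasBoundedInverseGain) :
    S.IsSolution c ω y z ↔
      IsTrajectory (funnelDomain n c) (S.closedLoop c) S.t₀ ω fun t => (y t, z t) := by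
  constructor
  · intro h
    exact ⟨h.lt, h.inFunnel, .prodMk (.pi (h.y_deriv_edgeSum hgain)) (.pi h.z_deriv)⟩
  · intro h
    have hy := h.deriv.clm_comp (ContinuousLinearMap.fst ℝ _ _)
    have hz := h.deriv.clm_comp (ContinuousLinearMap.snd ℝ _ _)
    refine ⟨h.lt, h.mem, fun i => ?_, hz.apply⟩
    exact (hy.apply i).congr_deriv fun t ht _ => by
      rw [mulVec_input hgain ht.le]; rfl

theorem isMaximalSolution_iff_isMaximalTrajectory (hgain : S.HasBoundedInverseGain) :
    S.IsMaximalSolution c ω y z ↔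
      IsMaximalTrajectory (funnelDomain n c) (S.closedLoop c) S.t₀ ω fun t => (y t, z t) := by
  refine and_congr (isSolution_iff_isTrajectory hgain) ⟨fun h ω' x' hx' hω hext => ?_,
    fun h ω' y' z' hx' hω hext => ?_⟩
  · exact h ω' (fun t => (x' t).1) (fun t => (x' t).2)
      ((isSolution_iff_isTrajectory hgain).2 hx') hω
      fun t ht htω => Prod.ext_iff.1 (hext t ht htω)
  · exact h ω' _ ((isSolution_iff_isTrajectory hgain).1 hx') hω
      fun t ht htω => Prod.ext_iff.2 (hext t ht htω)

theorem IsRegular.exists_bound (hreg : S.IsRegular) (R : ℝ) : ∃ M, 0 ≤ M ∧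
    ∀ i t y z, S.t₀ ≤ t → ‖(y, z)‖ ≤ R → ‖S.F i t y z‖ ≤ M ∧ ‖S.Z i t z y‖ ≤ M := by
  choose A hA using fun i => (hreg.F_field i).exists_forall_norm_le R
  choose B hB using fun i => (hreg.Z_field i).exists_forall_norm_le R
  obtain ⟨MF, hMF⟩ := Finite.exists_le A
  obtain ⟨MZ, hMZ⟩ := Finite.exists_le B
  exact ⟨max 0 (max MF MZ), le_max_left _ _, fun i t y z ht hyz =>
    ⟨((hA i t ht _ hyz).trans (hMF i)).trans ((le_max_left _ _).trans (le_max_right _ _)),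
      ((hB i t ht _ hyz).trans (hMZ i)).trans ((le_max_right _ _).trans (le_max_right _ _))⟩⟩

theorem norm_pair_le (x : State N m n) (i : Fin N) : ‖(x.1 i, x.2 i)‖ ≤ ‖x‖ :=
  max_le_max (norm_le_pi_norm x.1 i) (norm_le_pi_norm x.2 i)

theorem exists_closedLoop_bound (hreg : S.IsRegular) (hc : c.IsAdmissible S.t₀) (R : ℝ) {ε : ℝ}
    (hε : 0 < ε) : ∃ M : NNReal, ∀ t, S.t₀ ≤ t → ∀ x : State N m n, ‖x‖ ≤ R →
      c.HasMargin ε t x.1 → ‖S.closedLoop c t x‖ ≤ M := by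
  obtain ⟨A, hA₀, hA⟩ := hreg.exists_bound R
  obtain ⟨K, hK₀, hK⟩ := hc.exists_edgeSum_bound hε
  lift A to NNReal using hA₀
  lift K to NNReal using hK₀
  refine ⟨A + K, fun t ht x hx hmargin => ?_⟩
  have hfield := fun i => hA i t (x.1 i) (x.2 i) ht ((norm_pair_le x i).trans hx)
  refine max_le ((pi_norm_le_iff_of_nonneg (NNReal.coe_nonneg _)).2 fun i => ?_)
    ((pi_norm_le_iff_of_nonneg (NNReal.coe_nonneg _)).2 fun i => ?_)
  · exact (norm_add_le _ _).trans (add_le_add (hfield i).1 (hK t ht x.1 hmargin i))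
  · exact (hfield i).2.trans (le_add_of_nonneg_right K.2)

theorem aestronglyMeasurable_closedLoop (hreg : S.IsRegular) (hc : c.IsAdmissible S.t₀) {a b : ℝ}
    (ha : S.t₀ ≤ a) {x : State N m n} (hx : ∀ t ∈ Icc a b, c.InFunnel t x.1) :
    AEStronglyMeasurable (fun t => S.closedLoop c t x) (volume.restrict (Icc a b)) := by
  have hsub : Icc a b ⊆ Ici S.t₀ := Icc_subset_Ici_self.trans (Ici_subset_Ici.2 ha)
  have hle := Measure.restrict_mono hsub le_rfl (μ := volume)
  refine .prodMk (AEMeasurable.aestronglyMeasurable (aemeasurable_pi_iff.2 fun i => ?_))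
    (AEMeasurable.aestronglyMeasurable (aemeasurable_pi_iff.2 fun i => ?_))
  · have hedge := hc.continuousOn_edgeSum continuousOn_id hsub continuousOn_const hx i
    exact (((hreg.F_field i).measurable (x.1 i, x.2 i)).mono_measure hle).aemeasurable.add
      (hedge.aemeasurable measurableSet_Icc)
  · exact (((hreg.Z_field i).measurable (x.1 i, x.2 i)).mono_measure hle).aemeasurable

theorem continuousOn_closedLoop (hreg : S.IsRegular) (hc : c.IsAdmissible S.t₀) {t : ℝ}
    (ht : S.t₀ ≤ t) : ContinuousOn (S.closedLoop c t) (funnelDomain n c t) := by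
  have hpair : ∀ i, Continuous fun x : State N m n => (x.1 i, x.2 i) := fun i => by fun_prop
  refine .prodMk (continuousOn_pi.2 fun i => ?_) (continuousOn_pi.2 fun i => ?_)
  · exact (((hreg.F_field i).continuous ht).comp (hpair i)).continuousOn.add
      (hc.continuousOn_edgeSum continuousOn_const (fun _ _ => ht) continuousOn_fst
        (fun _ hx => hx) i)
  · exact (((hreg.Z_field i).continuous ht).comp (hpair i)).continuousOn

theorem isLocallySolvable_closedLoop (hreg : S.IsRegular) (hc : c.IsAdmissible S.t₀) :
    IsLocallySolvable (funnelDomain n c) (S.closedLoop c) S.t₀ := by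
  intro a ha x₀ hx₀
  obtain ⟨ε, hε, hnear⟩ := FunnelCoupling.InFunnel.eventually_hasMargin hc ha hx₀
  have htube : ∀ᶠ q : ℝ × State N m n in 𝓝[≥] a ×ˢ 𝓝 x₀, c.HasMargin ε q.1 q.2.1 :=
    (tendsto_fst.prodMk ((continuous_fst.tendsto x₀).comp tendsto_snd)).eventually hnear
  obtain ⟨⟨b, r⟩, ⟨hab, hr⟩, hbox⟩ :=
    (nhdsGE_basis_Icc.prod Metric.nhds_basis_closedBall).eventually_iff.1 htube
  have hmargin : ∀ t ∈ Icc a b, ∀ x ∈ Metric.closedBall x₀ r, c.HasMargin ε t x.1 :=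
    fun t ht x hx => @hbox (t, x) ⟨ht, hx⟩
  have hin : ∀ t ∈ Icc a b, ∀ x ∈ Metric.closedBall x₀ r, c.InFunnel t x.1 :=
    fun t ht x hx => (hmargin t ht x hx).inFunnel hc hε (ha.trans ht.1)
  obtain ⟨M, hM⟩ := exists_closedLoop_bound hreg hc (‖x₀‖ + r) hε
  obtain ⟨b', hb', x, hxa, hlip, hxmem, hderiv⟩ :=
    exists_lipschitzWith_hasDerivAt_of_bounded_closedBall hab hr
      (fun x hx => aestronglyMeasurable_closedLoop hreg hc ha fun t ht => hin t ht x hx)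
      (fun t ht => (continuousOn_closedLoop hreg hc (ha.trans ht.1)).mono (hin t ht))
      (fun t ht x hx => hM t (ha.trans ht.1) x (norm_le_of_mem_closedBall hx) (hmargin t ht x hx))
  exact ⟨b', hb'.1, x, M, hxa, hlip,
    fun t ht => hin t ⟨ht.1, ht.2.trans hb'.2⟩ _ (hxmem t ht), hderiv⟩

theorem exists_maximalSolution (hreg : S.IsRegular) (hgain : S.HasBoundedInverseGain)
    (hc : c.IsAdmissible S.t₀) {y₀ : Fin N → Fin m → ℝ} (z₀ : (i : Fin N) → Fin (n i) → ℝ)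
    (hy₀ : c.InFunnel S.t₀ y₀) :
    ∃ ω y z, S.IsMaximalSolution c ω y z ∧ y S.t₀ = y₀ ∧ z S.t₀ = z₀ := by
  obtain ⟨ω, x, hx, hx₀⟩ := (isLocallySolvable_closedLoop hreg hc).exists_isMaximalTrajectory
    (x₀ := ((y₀, z₀) : State N m n)) hy₀
  exact ⟨ω, fun t => (x t).1, fun t => (x t).2,
    (isMaximalSolution_iff_isMaximalTrajectory hgain).2 hx, Prod.ext_iff.1 hx₀⟩

theorem IsMaximalSolution.eq_top_of_hasBoundedStates (hx : S.IsMaximalSolution c ω y z)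
    (hreg : S.IsRegular) (hgain : S.HasBoundedInverseGain) (hc : c.IsAdmissible S.t₀) {ε : ℝ}
    (hε : 0 < ε) (hmargin : ∀ t, S.t₀ ≤ t → (t : EReal) < ω → c.HasMargin ε t (y t))
    (hbdd : S.HasBoundedStates ω y z) : ω = ⊤ := by
  obtain ⟨R, hR⟩ := hbdd
  have hmax := (isMaximalSolution_iff_isMaximalTrajectory hgain).1 hx
  have hnorm : ∀ t, S.t₀ ≤ t → (t : EReal) < ω → ‖((y t, z t) : State N m n)‖ ≤ max R 0 :=
    fun t ht htω => max_le
      ((pi_norm_le_iff_of_nonneg (le_max_right _ _)).2 fun i =>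
        ((le_max_left _ _).trans (hR i t ht htω)).trans (le_max_left _ _))
      ((pi_norm_le_iff_of_nonneg (le_max_right _ _)).2 fun i =>
        ((le_max_right _ _).trans (hR i t ht htω)).trans (le_max_left _ _))
  obtain ⟨M, hM⟩ := exists_closedLoop_bound hreg hc (max R 0) hε
  refine hmax.eq_top_of_lipschitz (isLocallySolvable_closedLoop hreg hc)
    (hmax.1.deriv.lipschitzOnWith fun t ht htω => hM t ht.le _ (hnorm t ht.le htω)
      (hmargin t ht.le htω)) fun T x₁ hT hlt hlim => ?_
  have hbefore : Ioo S.t₀ T ∈ 𝓝[<] T := Ioo_mem_nhdsLT hlt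
  refine (FunnelCoupling.HasMargin.of_tendsto hc hlt.le ?_
    ((continuous_fst.tendsto _).comp hlim) (mem_of_superset hbefore fun t ht =>
      hmargin t ht.1.le (hT ▸ EReal.coe_lt_coe ht.2))).inFunnel hc hε hlt.le
  exact le_inf nhdsWithin_le_nhds
    (le_principal_iff.2 (mem_of_superset hbefore fun t ht => ht.1.le))

end AgentNetwork

/-! ### The average of the agents and the largest performance function -/

section AgentMean

variable {E : Type*} [NormedAddCommGroup E] [NormedSpace ℝ E] {N : ℕ}

/-- The arithmetic mean of the vectors attached to the `N` agents. -/
noncomputable def agentMean (v : Fin N → E) : E :=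
  (1 / (N : ℝ)) • ∑ i, v i

theorem agentMean_sub (v w : Fin N → E) :
    agentMean (fun i => v i - w i) = agentMean v - agentMean w := by
  rw [agentMean, Finset.sum_sub_distrib, smul_sub, agentMean, agentMean]

theorem agentMean_const [Nonempty (Fin N)] (x : E) : agentMean (fun _ : Fin N => x) = x := by
  have hN : (N : ℝ) ≠ 0 := Nat.cast_ne_zero.2 (Fin.pos (Classical.arbitrary _)).ne'
  rw [agentMean, Finset.sum_const, Finset.card_univ, Fintype.card_fin, ← Nat.cast_smul_eq_nsmul ℝ,
    smul_smul, one_div_mul_cancel hN, one_smul]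

theorem norm_agentMean_le {v : Fin N → E} {r : ℝ} (hr : 0 ≤ r) (hv : ∀ i, ‖v i‖ ≤ r) :
    ‖agentMean v‖ ≤ r := by
  rw [agentMean, norm_smul, Real.norm_of_nonneg (by positivity), one_div_mul_eq_div]
  refine div_le_of_le_mul₀ (Nat.cast_nonneg N) hr ((norm_sum_le _ _).trans ?_)
  simpa only [Fintype.card_fin, mul_comm r] using sum_le_card_mul hr fun i _ => hv i

theorem norm_sub_agentMean_le [Nonempty (Fin N)] {x : E} {v : Fin N → E} {r : ℝ} (hr : 0 ≤ r)
    (hv : ∀ i, ‖x - v i‖ ≤ r) : ‖x - agentMean v‖ ≤ r := by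
  simpa only [agentMean_sub, agentMean_const] using norm_agentMean_le hr hv

end AgentMean

theorem sum_sum_eq_zero_of_antisymm {ι : Type*} [Fintype ι] {f : ι → ι → ℝ}
    (hf : ∀ i j, f i j = -f j i) : ∑ i, ∑ j, f i j = 0 := by
  refine self_eq_neg.1 ?_
  calc ∑ i, ∑ j, f i j = ∑ i, ∑ j, f j i := Finset.sum_comm
    _ = ∑ i, ∑ j, -f i j := by simp only [← hf]
    _ = -∑ i, ∑ j, f i j := by simp only [Finset.sum_neg_distrib]

namespace FunnelCoupling

variable {N m : ℕ} {c : FunnelCoupling N m} {t₀ t : ℝ}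

theorem le_Psi {i j : Fin N} (hij : c.graph.Adj i j) (p : Fin m) (t : ℝ) :
    c.ψ i j p t ≤ c.Psi t :=
  le_ciSup (f := fun q : c.EdgeComponent => c.ψ q.1.1 q.1.2.1 q.1.2.2 t)
    (finite_range _).bddAbove ⟨(i, j, p), hij⟩

theorem abs_sub_le_length_mul_Psi {y : Fin N → Fin m → ℝ} (hy : c.InFunnel t y) (p : Fin m)
    {i j : Fin N} (w : c.graph.Walk i j) : |y j p - y i p| ≤ w.length * c.Psi t := by
  induction w with
  | nil => simp
  | @cons a b d hab w ih =>
    rw [SimpleGraph.Walk.length_cons, Nat.cast_succ, add_mul, one_mul]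
    exact (abs_sub_le _ (y b p) _).trans
      (add_le_add ih ((hy a b hab p).le.trans (le_Psi hab p t)))

namespace IsAdmissible

theorem Psi_nonneg (hc : c.IsAdmissible t₀) (ht : t₀ ≤ t) : 0 ≤ c.Psi t :=
  Real.iSup_nonneg fun q => (hc.ψ_pos _ _ q.2 _ t ht).le

theorem diam_mul_Psi_nonneg (hc : c.IsAdmissible t₀) (ht : t₀ ≤ t) :
    0 ≤ (c.graph.diam : ℝ) * c.Psi t :=
  mul_nonneg (Nat.cast_nonneg _) (hc.Psi_nonneg ht)

theorem exists_Psi_le (hc : c.IsAdmissible t₀) : ∃ B, ∀ t, t₀ ≤ t → c.Psi t ≤ B := by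
  choose b hb using fun q : c.EdgeComponent => hc.ψ_bounded _ _ q.2 q.1.2.2
  obtain ⟨B, hB⟩ := Finite.exists_le b
  exact ⟨max B 0, fun t ht => Real.iSup_le
    (fun q => ((hb q t ht).trans (hB q)).trans (le_max_left _ _)) (le_max_right _ _)⟩

theorem exists_Psi_lipschitz (hc : c.IsAdmissible t₀) :
    ∃ B : NNReal, LipschitzOnWith B c.Psi (Ici t₀) := by
  obtain ⟨B, hB⟩ := hc.exists_isFunnel
  refine ⟨B, LipschitzOnWith.of_le_add_mul B fun s hs t ht => Real.iSup_le (fun q => ?_)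
    (add_nonneg (hc.Psi_nonneg ht) (by positivity))⟩
  have hψ := ((hB q.1.2.2).lipschitz _ _ q.2).le_add_mul hs ht
  exact hψ.trans (add_le_add_left (le_Psi q.2 q.1.2.2 t) _)

theorem norm_sub_le_diam_mul_Psi (hc : c.IsAdmissible t₀) (ht : t₀ ≤ t) {y : Fin N → Fin m → ℝ}
    (hy : c.InFunnel t y) (i j : Fin N) : ‖y i - y j‖ ≤ c.graph.diam * c.Psi t := by
  have : Nonempty (Fin N) := hc.connected.nonempty
  obtain ⟨w, hw⟩ := hc.connected.exists_walk_length_eq_dist j i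
  have hlength : w.length ≤ c.graph.diam :=
    hw ▸ SimpleGraph.dist_le_diam (SimpleGraph.connected_iff_ediam_ne_top.1 hc.connected)
  refine (pi_norm_le_iff_of_nonneg (hc.diam_mul_Psi_nonneg ht)).2 fun p => ?_
  exact (abs_sub_le_length_mul_Psi hy p w).trans
    (mul_le_mul_of_nonneg_right (Nat.cast_le.2 hlength) (hc.Psi_nonneg ht))

theorem norm_sub_agentMean_le (hc : c.IsAdmissible t₀) (ht : t₀ ≤ t) {y : Fin N → Fin m → ℝ}
    (hy : c.InFunnel t y) (i : Fin N) : ‖y i - agentMean y‖ ≤ c.graph.diam * c.Psi t :=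
  have : Nonempty (Fin N) := hc.connected.nonempty
  _root_.norm_sub_agentMean_le (hc.diam_mul_Psi_nonneg ht) (hc.norm_sub_le_diam_mul_Psi ht hy i)

theorem sum_edgeSum (hc : c.IsAdmissible t₀) (ht : t₀ ≤ t) {y : Fin N → Fin m → ℝ}
    (hy : c.InFunnel t y) : ∑ i, c.edgeSum i t y = 0 := by
  classical
  funext p
  simp only [Finset.sum_apply, edgeSum_apply, couplingSum, Finset.sum_filter, Pi.zero_apply]
  refine sum_sum_eq_zero_of_antisymm fun i j => ?_
  by_cases hij : c.graph.Adj i j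
  · rw [if_pos hij, if_pos hij.symm, ← hc.ψ_symm i j hij p t ht, ← neg_sub (y i p) (y j p),
      neg_div, hc.μ_symm i j hij p]
    exact div_mem_Ioo_of_abs_lt (abs_sub_comm (y j p) (y i p) ▸ hy i j hij p)
  · rw [if_neg hij, if_neg fun h => hij h.symm, neg_zero]

end IsAdmissible

end FunnelCoupling

/-! ### Lipschitz extensions below a Lipschitz bound -/

theorem lipschitzOnWith_clamp {α : Type*} [PseudoMetricSpace α] {K : NNReal} {ρ f : α → ℝ}
    {s : Set α} (hρ : LipschitzOnWith K ρ s) (hf : LipschitzOnWith K f s) :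
    LipschitzOnWith K (fun x => max (-ρ x) (min (ρ x) (f x))) s := by
  refine LipschitzOnWith.of_dist_le_mul fun a ha b hb => ?_
  have hρab := hρ.dist_le_mul a ha b hb
  have hfab := hf.dist_le_mul a ha b hb
  rw [Real.dist_eq] at hρab hfab ⊢
  refine (abs_max_sub_max_le_max _ _ _ _).trans (max_le ?_ ?_)
  · rwa [neg_sub_neg, abs_sub_comm]
  · exact (abs_min_sub_min_le_max _ _ _ _).trans (max_le hρab hfab)

theorem exists_lipschitzOnWith_extension_norm_le {α ι : Type*} [PseudoMetricSpace α] [Fintype ι]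
    {K : NNReal} {f : α → ι → ℝ} {ρ : α → ℝ} {s t : Set α} (hf : LipschitzOnWith K f s)
    (hρ : LipschitzOnWith K ρ t) (hρ₀ : ∀ x ∈ t, 0 ≤ ρ x) (hle : ∀ x ∈ s, ‖f x‖ ≤ ρ x) :
    ∃ g, LipschitzOnWith K g t ∧ (∀ x ∈ t, ‖g x‖ ≤ ρ x) ∧ EqOn g f s := by
  obtain ⟨g, hg, hfg⟩ := hf.extend_pi
  refine ⟨fun x i => max (-ρ x) (min (ρ x) (g x i)), ?_, fun x hx => ?_, fun x hx => ?_⟩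
  · have hclamp : ∀ i, LipschitzOnWith K (fun x => max (-ρ x) (min (ρ x) (g x i))) t := fun i =>
      lipschitzOnWith_clamp hρ (LipschitzWith.of_dist_le_mul fun a b =>
        (dist_le_pi_dist _ _ i).trans (hg.dist_le_mul a b)).lipschitzOnWith
    exact LipschitzOnWith.of_dist_le_mul fun a ha b hb => (dist_pi_le_iff (by positivity)).2
      fun i => (hclamp i).dist_le_mul a ha b hb
  · refine (pi_norm_le_iff_of_nonneg (hρ₀ x hx)).2 fun i => abs_le.2 ⟨le_max_left _ _, ?_⟩
    exact max_le (neg_le_self (hρ₀ x hx)) (min_le_left _ _)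
  · funext i
    have hi := abs_le.1 ((norm_le_pi_norm (f x) i).trans (hle x hx))
    simp only [← hfg hx, min_eq_right hi.2, max_eq_right hi.1]

/-! ### Uniqueness for the blended dynamics -/

namespace AgentNetwork

variable {N m : ℕ} {n k : Fin N → ℕ} {S : AgentNetwork N m n k} {c : FunnelCoupling N m}
  {ω : EReal} {y : ℝ → Fin N → Fin m → ℝ} {z : ℝ → (i : Fin N) → Fin (n i) → ℝ}

/-- The right-hand side of the blended dynamics with perturbations `e`, for the joint state
`(s, (z_i)_i)`. -/
noncomputable def blendedField (S : AgentNetwork N m n k) (e : ℝ → Fin N → Fin m → ℝ) (t : ℝ)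
    (x : (Fin m → ℝ) × ((i : Fin N) → Fin (n i) → ℝ)) :
    (Fin m → ℝ) × ((i : Fin N) → Fin (n i) → ℝ) :=
  (agentMean fun i => S.F i t (x.1 + e t i) (x.2 i), fun i => S.Z i t (x.2 i) (x.1 + e t i))

theorem norm_blendedField_sub_le {e : ℝ → Fin N → Fin m → ℝ} {t r : ℝ}
    {x x' : (Fin m → ℝ) × ((i : Fin N) → Fin (n i) → ℝ)} (hr : 0 ≤ r)
    (hF : ∀ i, ‖S.F i t (x.1 + e t i) (x.2 i) - S.F i t (x'.1 + e t i) (x'.2 i)‖ ≤ r)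
    (hZ : ∀ i, ‖S.Z i t (x.2 i) (x.1 + e t i) - S.Z i t (x'.2 i) (x'.1 + e t i)‖ ≤ r) :
    ‖S.blendedField e t x - S.blendedField e t x'‖ ≤ r := by
  refine max_le ?_ ((pi_norm_le_iff_of_nonneg hr).2 hZ)
  have hmean := norm_agentMean_le hr hF
  rwa [agentMean_sub] at hmean

theorem IsRegular.exists_eventually_norm_blendedField_sub_le (hreg : S.IsRegular)
    {e : ℝ → Fin N → Fin m → ℝ} (he : ContinuousOn e (Ici S.t₀))
    {x x' : ℝ → (Fin m → ℝ) × ((i : Fin N) → Fin (n i) → ℝ)} {t T : ℝ} (ht : S.t₀ ≤ t)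
    (hx : ContinuousWithinAt x (Ioi t) t) (hx' : ContinuousWithinAt x' (Ioi t) t)
    (heq : x t = x' t) :
    ∃ Λ : ℝ → ℝ, (∀ r, 0 ≤ Λ r) ∧ IntegrableOn Λ (Icc t T) ∧ ∀ᶠ r in 𝓝[>] t,
      ‖S.blendedField e r (x r) - S.blendedField e r (x' r)‖ ≤ Λ r * ‖x r - x' r‖ := by
  have harg : ∀ {x : ℝ → (Fin m → ℝ) × ((i : Fin N) → Fin (n i) → ℝ)} (i),
      ContinuousWithinAt x (Ioi t) t →
        ContinuousWithinAt (fun r => ((x r).1 + e r i, (x r).2 i)) (Ioi t) t := fun i hx =>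
    (hx.fst.add (continuousWithinAt_pi.1
      ((he t ht).mono fun r hr => ht.trans (le_of_lt hr)) i)).prodMk
        (continuousWithinAt_pi.1 hx.snd i)
  have hpair : ∀ r i, ‖((x r).1 + e r i, (x r).2 i) - ((x' r).1 + e r i, (x' r).2 i)‖ ≤
      ‖x r - x' r‖ := fun r i => by
    rw [Prod.mk_sub_mk, add_sub_add_right_eq_sub]
    exact max_le_max le_rfl (norm_le_pi_norm ((x r).2 - (x' r).2) i)
  choose L hL₀ hL hF using fun i => (hreg.F_field i).exists_eventually_norm_sub_le ht T
    (harg i hx) (harg i hx') (by rw [heq])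
  choose L' hL₀' hL' hZ using fun i => (hreg.Z_field i).exists_eventually_norm_sub_le ht T
    (harg i hx) (harg i hx') (by rw [heq])
  have hnonneg : ∀ r i, 0 ≤ L i r + L' i r := fun r i => add_nonneg (hL₀ i r) (hL₀' i r)
  have hsum : ∀ r i, L i r + L' i r ≤ ∑ i, (L i r + L' i r) := fun r i =>
    Finset.single_le_sum (f := fun i => L i r + L' i r) (fun i _ => hnonneg r i)
      (Finset.mem_univ i)
  refine ⟨fun r => ∑ i, (L i r + L' i r), fun r => Finset.sum_nonneg fun i _ => hnonneg r i,
    integrable_finsetSum _ fun i _ => (hL i).add (hL' i), ?_⟩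
  filter_upwards [eventually_all.2 hF, eventually_all.2 hZ] with r hFr hZr
  refine norm_blendedField_sub_le
    (mul_nonneg (Finset.sum_nonneg fun i _ => hnonneg r i) (norm_nonneg _))
    (fun i => ?_) fun i => ?_
  · exact (hFr i).trans (mul_le_mul ((le_add_of_nonneg_right (hL₀' i r)).trans (hsum r i))
      (hpair r i) (norm_nonneg _) ((hnonneg r i).trans (hsum r i)))
  · exact (hZr i).trans (mul_le_mul ((le_add_of_nonneg_left (hL₀ i r)).trans (hsum r i))
      (hpair r i) (norm_nonneg _) ((hnonneg r i).trans (hsum r i)))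

theorem IsRegular.eq_of_hasCaratheodoryDeriv_blendedField (hreg : S.IsRegular)
    {e : ℝ → Fin N → Fin m → ℝ} (he : ContinuousOn e (Ici S.t₀))
    {x x' : ℝ → (Fin m → ℝ) × ((i : Fin N) → Fin (n i) → ℝ)}
    (hx : HasCaratheodoryDeriv S.t₀ ω x fun t => S.blendedField e t (x t))
    (hx' : HasCaratheodoryDeriv S.t₀ ω x' fun t => S.blendedField e t (x' t))
    (hx₀ : x S.t₀ = x' S.t₀) {T : ℝ} (hT : S.t₀ ≤ T) (hTω : (T : EReal) < ω) : x T = x' T := by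
  have hright : ∀ {x : ℝ → (Fin m → ℝ) × ((i : Fin N) → Fin (n i) → ℝ)},
      ContinuousOn x (Icc S.t₀ T) → ∀ t ∈ Ico S.t₀ T, ContinuousWithinAt x (Ioi t) t :=
    fun hx t ht => (hx t (Ico_subset_Icc_self ht)).mono_of_mem_nhdsWithin
      (mem_of_superset (Ioo_mem_nhdsGT ht.2) fun r hr => ⟨ht.1.trans hr.1.le, hr.2.le⟩)
  refine sub_eq_zero.1 ((hx.sub hx').eq_zero_of_forall_exists_norm_le hT hTω
    (sub_eq_zero.2 hx₀) fun t ht heq => ?_)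
  exact hreg.exists_eventually_norm_blendedField_sub_le he ht.1
    (hright (hx.continuousOn hT hTω) t ht) (hright (hx'.continuousOn hT hTω) t ht)
    (sub_eq_zero.1 heq)

/-! ### Global existence -/

/-- The uncoupled output dynamics of any two agents differ by a bounded amount along `(y, z)` on
`[t₀, ω)`. This is all that the funnel estimate needs from the alternatives (a) and (b). -/
def HasBoundedSpread (S : AgentNetwork N m n k) (ω : EReal)
    (y : ℝ → Fin N → Fin m → ℝ) (z : ℝ → (i : Fin N) → Fin (n i) → ℝ) : Prop :=
  ∃ C : ℝ, ∀ t, S.t₀ ≤ t → (t : EReal) < ω → ∀ i j,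
    ‖S.F i t (y t i) (z t i) - S.F j t (y t j) (z t j)‖ ≤ C

theorem HasBoundedStates.hasBoundedSpread (hb : S.HasBoundedStates ω y z) (hreg : S.IsRegular) :
    S.HasBoundedSpread ω y z := by
  obtain ⟨R, hR⟩ := hb
  obtain ⟨M, -, hM⟩ := hreg.exists_bound R
  exact ⟨M + M, fun t ht htω i j => norm_sub_le_of_le (hM i t _ _ ht (hR i t ht htω)).1
    (hM j t _ _ ht (hR j t ht htω)).1⟩

theorem HasLipschitzPlusBoundedSplitting.hasBoundedSpread
    (hF : S.HasLipschitzPlusBoundedSplitting) (hc : c.IsAdmissible S.t₀)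
    (h : S.IsSolution c ω y z) : S.HasBoundedSpread ω y z := by
  obtain ⟨Fhat, Ftilde, hsplit, ⟨L, hL⟩, M, hM⟩ := hF
  obtain ⟨B, hB⟩ := hc.exists_Psi_le
  refine ⟨|L| * (c.graph.diam * B) + (M + M), fun t ht htω i j => ?_⟩
  have hdist : ‖y t i - y t j‖ ≤ c.graph.diam * B :=
    (hc.norm_sub_le_diam_mul_Psi ht (h.inFunnel t ht htω) i j).trans
      (mul_le_mul_of_nonneg_left (hB t ht) (Nat.cast_nonneg _))
  rw [hsplit i t _ _ ht, hsplit j t _ _ ht, add_sub_add_comm]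
  refine norm_add_le_of_le ((hL t _ _ ht).trans ?_)
    (norm_sub_le_of_le (hM i t _ _ ht) (hM j t _ _ ht))
  exact mul_le_mul (le_abs_self L) hdist (norm_nonneg _) (abs_nonneg L)

namespace IsSolution

theorem isScalarSolution (h : S.IsSolution c ω y z) (hgain : S.HasBoundedInverseGain)
    (p : Fin m) :
    IsScalarSolution c.graph (fun i j => c.ψ i j p) (fun i j => c.μ i j p) S.t₀ ω
      (fun t i => S.F i t (y t i) (z t i) p) (fun t i => y t i p) where
  deriv i := ((h.y_deriv_edgeSum hgain i).apply p).congr_deriv fun t _ _ => by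
    rw [Pi.add_apply, FunnelCoupling.edgeSum_apply]
  abs_lt t ht htω i j hij := h.inFunnel t ht htω i j hij p

theorem exists_margin (h : S.IsSolution c ω y z) (hgain : S.HasBoundedInverseGain)
    (hc : c.IsAdmissible S.t₀) (hF : S.HasBoundedSpread ω y z) :
    ∃ ε > 0, ∀ t, S.t₀ ≤ t → (t : EReal) < ω → c.HasMargin ε t (y t) := by
  obtain ⟨C, hC⟩ := hF
  obtain ⟨B, hB⟩ := hc.exists_isFunnel
  choose δ hδ hmargin using fun p => (h.isScalarSolution hgain p).exists_margin h.lt (hB p)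
    (fun i j hij => hc.isPolarCoupling hij p) (C := C) fun t ht htω i j =>
      (le_abs_self _).trans ((norm_le_pi_norm _ p).trans (hC t ht htω i j))
  obtain ⟨ε, hεδ, hε⟩ : ∃ ε, (∀ p, ε < δ p) ∧ 0 < ε :=
    ((eventually_all.2 fun p => mem_nhdsWithin_of_mem_nhds (Iio_mem_nhds (hδ p).1)).and
      (self_mem_nhdsWithin : Ioi (0 : ℝ) ∈ 𝓝[>] 0)).exists
  refine ⟨ε, hε, fun t ht htω i j hij p => (hmargin p t ht htω i j hij).trans ?_⟩
  exact mul_le_mul_of_nonneg_right (sub_le_sub_left (hεδ p).le 1) (hc.ψ_pos i j hij p t ht).le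

theorem agentMean_deriv (h : S.IsSolution c ω y z) (hgain : S.HasBoundedInverseGain)
    (hc : c.IsAdmissible S.t₀) :
    HasCaratheodoryDeriv S.t₀ ω (fun t => agentMean (y t))
      (fun t => agentMean fun i => S.F i t (y t i) (z t i)) := by
  have hsum := (HasCaratheodoryDeriv.finset_sum Finset.univ fun i _ =>
    h.y_deriv_edgeSum hgain i).clm_comp
      ((1 / (N : ℝ)) • ContinuousLinearMap.id ℝ (Fin m → ℝ))
  refine hsum.congr_deriv fun t ht htω => ?_
  change (1 / (N : ℝ)) • ∑ i, (S.F i t (y t i) (z t i) + c.edgeSum i t (y t)) = _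
  rw [Finset.sum_add_distrib, hc.sum_edgeSum ht.le (h.inFunnel t ht.le htω), add_zero, agentMean]

theorem exists_lipschitzOnWith_deviation (h : S.IsSolution c ω y z)
    (hgain : S.HasBoundedInverseGain) (hc : c.IsAdmissible S.t₀)
    (hF : S.HasBoundedSpread ω y z) :
    ∃ K, ∀ i, LipschitzOnWith K (fun t => y t i - agentMean (y t))
      {t | S.t₀ ≤ t ∧ (t : EReal) < ω} := by
  have : Nonempty (Fin N) := hc.connected.nonempty
  obtain ⟨ε, hε, hmargin⟩ := h.exists_margin hgain hc hF
  obtain ⟨A, hA₀, hA⟩ := hc.exists_edgeSum_bound hε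
  obtain ⟨C, hC⟩ := hF
  have hC₀ : 0 ≤ C := (norm_nonneg _).trans
    (hC S.t₀ le_rfl h.lt (Classical.arbitrary _) (Classical.arbitrary _))
  refine ⟨⟨C + A, add_nonneg hC₀ hA₀⟩, fun i =>
    ((h.y_deriv_edgeSum hgain i).sub (h.agentMean_deriv hgain hc)).lipschitzOnWith
      fun t ht htω => ?_⟩
  rw [add_sub_right_comm]
  exact norm_add_le_of_le (norm_sub_agentMean_le hC₀ (hC t ht.le htω i))
    (hA t ht.le _ (hmargin t ht.le htω) i)

theorem exists_deviation_extension (h : S.IsSolution c ω y z) (hgain : S.HasBoundedInverseGain)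
    (hc : c.IsAdmissible S.t₀) (hF : S.HasBoundedSpread ω y z) :
    ∃ (e : ℝ → Fin N → Fin m → ℝ) (K : NNReal),
      (∀ i, LipschitzOnWith K (fun t => e t i) (Ici S.t₀)) ∧
      (∀ i t, S.t₀ ≤ t → ‖e t i‖ ≤ c.graph.diam * c.Psi t) ∧
      ∀ i t, S.t₀ ≤ t → (t : EReal) < ω → e t i = y t i - agentMean (y t) := by
  obtain ⟨K, hK⟩ := h.exists_lipschitzOnWith_deviation hgain hc hF
  obtain ⟨B, hB⟩ := hc.exists_Psi_lipschitz
  have hρ : LipschitzOnWith (c.graph.diam * B) (fun t => c.graph.diam * c.Psi t) (Ici S.t₀) :=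
    LipschitzOnWith.of_dist_le_mul fun a ha b hb => by
      rw [Real.dist_eq, ← mul_sub, abs_mul, Nat.abs_cast, NNReal.coe_mul, NNReal.coe_natCast,
        mul_assoc]
      exact mul_le_mul_of_nonneg_left (hB.dist_le_mul a ha b hb) (Nat.cast_nonneg _)
  choose e he hle heq using fun i => exists_lipschitzOnWith_extension_norm_le
    ((hK i).weaken (le_max_left K (c.graph.diam * B)))
    (hρ.weaken (le_max_right K (c.graph.diam * B))) (fun t ht => hc.diam_mul_Psi_nonneg ht)
    fun t ht => hc.norm_sub_agentMean_le ht.1 (h.inFunnel t ht.1 ht.2) i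
  exact ⟨fun t i => e i t, _, he, hle, fun i t ht htω => heq i ⟨ht, htω⟩⟩

theorem agentMean_prodMk_deriv (h : S.IsSolution c ω y z) (hgain : S.HasBoundedInverseGain)
    (hc : c.IsAdmissible S.t₀) {e : ℝ → Fin N → Fin m → ℝ}
    (he : ∀ i t, S.t₀ ≤ t → (t : EReal) < ω → e t i = y t i - agentMean (y t)) :
    HasCaratheodoryDeriv S.t₀ ω (fun t => (agentMean (y t), z t))
      (fun t => S.blendedField e t (agentMean (y t), z t)) := by
  refine ((h.agentMean_deriv hgain hc).prodMk (HasCaratheodoryDeriv.pi h.z_deriv)).congr_deriv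
    fun t ht htω => ?_
  simp only [blendedField, he _ t ht.le htω, add_sub_cancel]

end IsSolution

theorem NoFiniteEscape.exists_blended (hesc : S.NoFiniteEscape c) {e : ℝ → Fin N → Fin m → ℝ}
    {K : NNReal} (heL : ∀ i, LipschitzOnWith K (fun t => e t i) (Ici S.t₀))
    (heb : ∀ i t, S.t₀ ≤ t → ‖e t i‖ ≤ c.graph.diam * c.Psi t)
    (x₀ : (Fin m → ℝ) × ((i : Fin N) → Fin (n i) → ℝ)) :
    ∃ x, x S.t₀ = x₀ ∧ HasCaratheodoryDeriv S.t₀ ⊤ x fun t => S.blendedField e t (x t) := by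
  obtain ⟨s, z, hs₀, hz₀, hs, hz⟩ := hesc e (fun i T hT =>
    ((heL i).mono (uIcc_of_le hT ▸ Icc_subset_Ici_self)).absolutelyContinuousOnInterval) heb
    x₀.1 x₀.2
  exact ⟨fun t => (s t, z t), Prod.ext hs₀ hz₀, hs.prodMk (HasCaratheodoryDeriv.pi hz)⟩

theorem IsSolution.hasBoundedStates {T : ℝ} (h : S.IsSolution c T y z)
    (hreg : S.IsRegular) (hgain : S.HasBoundedInverseGain) (hc : c.IsAdmissible S.t₀)
    (hesc : S.NoFiniteEscape c) (hF : S.HasBoundedSpread T y z) : S.HasBoundedStates T y z := by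
  obtain ⟨e, K, heL, heb, hey⟩ := h.exists_deviation_extension hgain hc hF
  obtain ⟨x, hx₀, hx⟩ := hesc.exists_blended heL heb (agentMean (y S.t₀), z S.t₀)
  have hec : ContinuousOn e (Ici S.t₀) := continuousOn_pi.2 fun i => (heL i).continuousOn
  have hxc : ContinuousOn x (Icc S.t₀ T) :=
    hx.continuousOn (EReal.coe_lt_coe_iff.1 h.lt).le (EReal.coe_lt_top T)
  have hstate : ∀ i t, S.t₀ ≤ t → (t : EReal) < T →
      (y t i, z t i) = ((x t).1 + e t i, (x t).2 i) := fun i t ht htT => by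
    rw [← hreg.eq_of_hasCaratheodoryDeriv_blendedField hec
      (h.agentMean_prodMk_deriv hgain hc hey) (hx.mono le_top) hx₀.symm ht htT, hey i t ht htT,
      add_sub_cancel]
  choose R hR using fun i => isCompact_Icc.exists_bound_of_continuousOn
    ((hxc.fst.add (continuousOn_pi.1 (hec.mono Icc_subset_Ici_self) i)).prodMk
      (continuousOn_pi.1 hxc.snd i))
  obtain ⟨M, hM⟩ := Finite.exists_le R
  refine ⟨M, fun i t ht htT => ?_⟩
  rw [hstate i t ht htT]
  exact (hR i t ⟨ht, (EReal.coe_lt_coe_iff.1 htT).le⟩).trans (hM i)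

theorem IsMaximalSolution.eq_top (h : S.IsMaximalSolution c ω y z) (hreg : S.IsRegular)
    (hgain : S.HasBoundedInverseGain) (hc : c.IsAdmissible S.t₀) (hesc : S.NoFiniteEscape c)
    (hF : S.HasBoundedSpread ω y z) : ω = ⊤ := by
  by_contra hω
  have hfinite := hω
  lift ω to ℝ using ⟨hω, (bot_le.trans_lt h.1.lt).ne'⟩
  obtain ⟨ε, hε, hmargin⟩ := h.1.exists_margin hgain hc hF
  exact hfinite (h.eq_top_of_hasBoundedStates hreg hgain hc hε hmargin
    (h.1.hasBoundedStates hreg hgain hc hesc hF))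

theorem IsSolution.exists_input_bound (h : S.IsSolution c ω y z)
    (hgain : S.HasBoundedInverseGain) (hc : c.IsAdmissible S.t₀)
    (hF : S.HasBoundedSpread ω y z) :
    ∃ M : ℝ, 0 < M ∧ ∀ t, S.t₀ ≤ t → (t : EReal) < ω → ∀ i,
      ‖S.input c i t (y t) (z t)‖ ≤ M := by
  obtain ⟨ε, hε, hmargin⟩ := h.exists_margin hgain hc hF
  obtain ⟨K, hK₀, hK⟩ := hc.exists_edgeSum_bound hε
  obtain ⟨-, M, hM₀, hM⟩ := hgain
  refine ⟨M * K + 1, add_pos_of_nonneg_of_pos (mul_nonneg hM₀.le hK₀) one_pos,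
    fun t ht htω i => ?_⟩
  exact (norm_input_le (hM i t _ ht) (hK t ht _ (hmargin t ht htω) i)).trans
    (le_add_of_nonneg_right zero_le_one)

end AgentNetwork

theorem theorem2 {N m : ℕ} {n k : Fin N → ℕ}
    (S : AgentNetwork N m n k) (c : FunnelCoupling N m)
    (hreg : S.IsRegular) (hgain : S.HasBoundedInverseGain)
    (hc : c.IsAdmissible S.t₀) (hesc : S.NoFiniteEscape c)
    (y₀ : Fin N → Fin m → ℝ) (z₀ : (i : Fin N) → Fin (n i) → ℝ)
    (hinit : c.InFunnel S.t₀ y₀) :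
    (∃ (ω : EReal) (y : ℝ → Fin N → Fin m → ℝ) (z : ℝ → (i : Fin N) → Fin (n i) → ℝ),
      S.IsMaximalSolution c ω y z ∧ y S.t₀ = y₀ ∧ z S.t₀ = z₀) ∧
    ∀ (ω : EReal) (y : ℝ → Fin N → Fin m → ℝ) (z : ℝ → (i : Fin N) → Fin (n i) → ℝ),
      S.IsMaximalSolution c ω y z → y S.t₀ = y₀ → z S.t₀ = z₀ →
      (S.HasLipschitzPlusBoundedSplitting ∨ S.HasBoundedStates ω y z) →
      ω = ⊤ ∧
      ∃ M : ℝ, 0 < M ∧ ∀ t, S.t₀ ≤ t → ∀ i, ‖S.input c i t (y t) (z t)‖ ≤ M := by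
  refine ⟨AgentNetwork.exists_maximalSolution hreg hgain hc z₀ hinit, fun ω y z h _ _ hab => ?_⟩
  have hspread : S.HasBoundedSpread ω y z :=
    hab.elim (fun ha => ha.hasBoundedSpread hc h.1) fun hb => hb.hasBoundedSpread hreg
  obtain rfl : ω = ⊤ := h.eq_top hreg hgain hc hesc hspread
  obtain ⟨M, hM₀, hM⟩ := h.1.exists_input_bound hgain hc hspread
  exact ⟨rfl, M, hM₀, fun t ht => hM t ht (EReal.coe_lt_top t)⟩
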